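/- **Conventions.** For a symmetric $B\in\mathbb R^{n\times n}$ let $\lambda_1(B)\ge\dots\ge\lambda_n(B)$ be its eigenvalues; for positive definite $B$ put $\kappa_2(B)=\lambda_1(B)/\lambda_n(B)$ and $\kappa_2^S(B)=\kappa_2(DBD)$ with $D=\operatorname{diag}(b_{ii}^{-1/2})$. $\|\cdot\|_2$ is the spectral norm, $|B|$ the entrywise absolute value. Floating-point arithmetic with unit roundoff $u$ means that every operation $+,-,\times,/,\sqrt{\cdot}$ returns $\mathrm{fl}(z)$, where $z$ is the exact result of the operation and $|\mathrm{fl}(z)-z|\le u|z|$ (no underflow or overflow). **Setting.** Let $A\in\mathbb R^{n\times n}$ be symmetric positive definite, $0<u_h<u<0.1$, $nu<1/2$, $\gamma_h=nu_h/(1-nu_h)$, and let $\widetilde Q\in\mathbb R^{n\times n}$ satisfy $\|\widetilde Q^T\widetilde Q-I\|_2\le p_1u<1$, where $p_1$ is a real number (which may depend on $n$). Put $\widetilde A=\widetilde Q^TA\widetilde Q=(\tilde a_{ij})$ and $$\alpha=\max_{i,j}\frac{(|\widetilde Q^T||A||\widetilde Q|)_{ij}}{\sqrt{\tilde a_{ii}\tilde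 a_{jj}}}.$$ Let $\widetilde A_{\rm comp}$ be obtained by computing $(\widetilde Q^TA)\widetilde Q$ with unit roundoff $u_h$ (sums in any order), rounding every entry with unit roundoff $u$, and symmetrizing the result $X$ (either $(X+X^T)/2$, or a symmetric matrix each of whose entries is the corresponding entry of $X$ or $X^T$). The Jacobi algorithm is run on $\widetilde A_{\rm comp}$ with unit roundoff $u$: starting from $H_0=\widetilde A_{\rm comp}$, $H_{m+1}$ is computed from $H_m$ by the two-sided rotation with pivot $(i,j)$, $i<j$, given by $\zeta=(h_{jj}-h_{ii})/(2h_{ij})$, $t=\operatorname{sign}(\zeta)/(|\zeta|+\sqrt{1+\zeta^2})$ with $\operatorname{sign}(0)=1$, $c=1/\sqrt{1+t^2}$, $s=ct$; $h_{ii}\leftarrow h_{ii}-h_{ij}t$, $h_{jj}\leftarrow h_{jj}+h_{ij}t$, $h_{ij},h_{ji}\leftarrow0$, and $h_{ik},h_{ki}\leftarrow ch_{ik}-sh_{jk}$, $h_{jk},h_{kj}\leftarrow sh_{ik}+ch_{jk}$ for $k\ne i,j$ (the matrix is left unchanged if $h_{ij}=0$). The pivots may be chosen in any order. The run stops with a matrix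 $H_M$ for which the computed test $|h_{ij}|\le \mathrm{tol}\sqrt{h_{ii}h_{jj}}$ holds for all $i\ne j$, where $0<\mathrm{tol}\le\tau nu$. The computed eigenvalue $\widehat\lambda_k(\widetilde A_{\rm comp})$ is the $k$th largest diagonal entry of $H_M$. Suppose that the run takes at most $S$ sweeps' worth of rotations, $M\le S\,n(n-1)/2$, and that $\kappa_2^S(H_m)\le G\,\kappa_2^S(\widetilde A_{\rm comp})$ for $0\le m<M$. **Theorem (intermediate bound).** For all $S\in\mathbb N$ and $\tau,G\in\mathbb R$ there is a real polynomial $p_2$ of degree at most two, depending only on $S,\tau,G$, such that the following holds for all $n$ and all data as above. Write $p_2$ for $p_2(n)$. If $$10\,n^{3/2}u\,(1-p_1u)^{-1}\kappa_2(A)<1\quad\text{(A1)}\qquad\text{and}\qquad\gamma_h<u,$$ then for every $k=1,\dots,n$ $$\frac{|\widehat\lambda_k(\widetilde A_{\rm comp})-\lambda_k(A)|}{\lambda_k(A)}\le p_2\,u\,\kappa_2^S(\widetilde A_{\rm comp})+(2nu+8n\gamma_h\alpha)\,\kappa_2^S(\widetilde A)+p_1u,$$ provided that each of the three terms on the right-hand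 side is less than $1$. -/

import Mathlib

open Matrix

noncomputable section

/-! ## Eigenvalues and condition numbers -/

/-- `eigDesc A k` is the `k`-th largest eigenvalue (counted with multiplicity, `k = 0` being the
largest) of a symmetric real matrix `A`; the value for a matrix that is not symmetric is a dummy. -/
def eigDesc {n : ℕ} (A : Matrix (Fin n) (Fin n) ℝ) (k : Fin n) : ℝ :=
  open Classical in
  if hA : A.IsHermitian then hA.eigenvalues₀ (Fin.cast (Fintype.card_fin n).symm k) else 0

/-- `κ₂(A) = λ₁(A) / λₙ(A)` for a symmetric positive definite matrix `A`. -/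
def cond2 {n : ℕ} (A : Matrix (Fin n) (Fin n) ℝ) : ℝ :=
  if h : 0 < n then eigDesc A ⟨0, h⟩ / eigDesc A ⟨n - 1, Nat.sub_lt h one_pos⟩ else 0

/-- The scaled condition number `κ₂ˢ(A) = κ₂(D A D)`, where `D = diag(a_ii ^ (-1/2))`. -/
def scaledCond2 {n : ℕ} (A : Matrix (Fin n) (Fin n) ℝ) : ℝ :=
  cond2 (diagonal (fun i => 1 / √(A i i)) * A * diagonal (fun i => 1 / √(A i i)))

/-- The spectral norm (the operator norm for the Euclidean vector norm). -/
def specNorm {n : ℕ} (A : Matrix (Fin n) (Fin n) ℝ) : ℝ :=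
  ‖toEuclideanCLM (n := Fin n) (𝕜 := ℝ) A‖

/-- The entrywise absolute value `|A|`. -/
def matAbs {n : ℕ} (A : Matrix (Fin n) (Fin n) ℝ) : Matrix (Fin n) (Fin n) ℝ :=
  A.map (fun x => |x|)

/-- `α = max_{i,j} (|Qᵀ| |A| |Q|)_{ij} / √(ã_ii ã_jj)`, where `ã` are the entries of `Qᵀ A Q`. -/
def alphaMax {n : ℕ} (A Q : Matrix (Fin n) (Fin n) ℝ) : ℝ :=
  ⨆ p : Fin n × Fin n, (matAbs Qᵀ * matAbs A * matAbs Q) p.1 p.2 /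
    √((Qᵀ * A * Q) p.1 p.1 * (Qᵀ * A * Q) p.2 p.2)

/-! ## Floating-point arithmetic

A precision is given by a rounding function `fl`; the computed value of `x op y` is `fl (x op y)`.
There is no underflow and no overflow. -/

/-- `fl` rounds with unit roundoff `u`: `fl x = x (1 + δ)` with `|δ| ≤ u`. -/
def IsRounding (u : ℝ) (fl : ℝ → ℝ) : Prop :=
  ∀ x : ℝ, |fl x - x| ≤ u * |x|

/-- Rounding to nearest in binary with `t` significant bits and unbounded exponent range. -/
def roundNearest (t : ℤ) (x : ℝ) : ℝ :=
  (round (x / 2 ^ (Int.log 2 |x| - t + 1)) : ℝ) * 2 ^ (Int.log 2 |x| - t + 1)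

/-- Rounding to nearest with `t` bits has unit roundoff `2 ^ (-t)`. -/
theorem isRounding_roundNearest (t : ℤ) : IsRounding ((2 : ℝ) ^ (-t)) (roundNearest t) := by
  intro x
  rcases eq_or_ne x 0 with rfl | hx
  · simp [roundNearest]
  have hx' : 0 < |x| := abs_pos.mpr hx
  have h1 : ((2 : ℕ) : ℝ) ^ Int.log 2 |x| ≤ |x| := Int.zpow_log_le_self (by norm_num) hx'
  set s : ℝ := (2 : ℝ) ^ (Int.log 2 |x| - t + 1) with hs
  have hspos : 0 < s := by positivity
  have hs2 : s = 2 * ((2 : ℝ) ^ (-t) * (2 : ℝ) ^ Int.log 2 |x|) := by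
    rw [hs, ← zpow_add₀ (by norm_num), ← zpow_one_add₀ (by norm_num)]
    congr 1
    ring
  have h2 : |x / s - round (x / s)| ≤ 1 / 2 := abs_sub_round _
  have h3 : roundNearest t x - x = -((x / s - round (x / s)) * s) := by
    rw [roundNearest, ← hs]
    field_simp
    ring
  rw [h3, abs_neg, abs_mul, abs_of_pos hspos]
  have h4 : (2 : ℝ) ^ (-t) * (2 : ℝ) ^ Int.log 2 |x| ≤ 2 ^ (-t) * |x| := by
    push_cast at h1
    gcongr
  nlinarith

/-- `IsFlSum fl f s x`: the number `x` is a computed value of `∑ i ∈ s, f i`, the summands being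
added in some order and with some bracketing, with one rounding for each addition. -/
inductive IsFlSum {ι : Type} [DecidableEq ι] (fl : ℝ → ℝ) (f : ι → ℝ) : Finset ι → ℝ → Prop
  | single (i : ι) : IsFlSum fl f {i} (f i)
  | add (s t : Finset ι) (x y : ℝ) (hst : Disjoint s t) (hx : IsFlSum fl f s x)
      (hy : IsFlSum fl f t y) : IsFlSum fl f (s ∪ t) (fl (x + y))

/-- `Z` is a computed value of the matrix product `X * Y`: every entry is a computed inner
product. -/
def IsFlMul {n : ℕ} (fl : ℝ → ℝ) (X Y Z : Matrix (Fin n) (Fin n) ℝ) : Prop :=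
  ∀ i j, IsFlSum fl (fun k => fl (X i k * Y k j)) Finset.univ (Z i j)

/-- `B` is a symmetrization of `X`: either the symmetric part of `X`, or a symmetric matrix each of
whose entries is the corresponding entry of `X` or of `Xᵀ` (one triangle of `X` is mirrored, or `X`
is symmetric already). -/
def IsSymmetrization {n : ℕ} (X B : Matrix (Fin n) (Fin n) ℝ) : Prop :=
  B = (1 / 2 : ℝ) • (X + Xᵀ) ∨ (B.IsSymm ∧ ∀ i j, B i j = X i j ∨ B i j = X j i)

/-- `B` is a computed preconditioned matrix: `Qᵀ A Q` is computed as `(Qᵀ A) Q` with the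
high-precision rounding `flh`, then rounded entrywise to working precision by `fl`, and
symmetrized. -/
def IsComputedPrecond {n : ℕ} (fl flh : ℝ → ℝ) (A Q B : Matrix (Fin n) (Fin n) ℝ) : Prop :=
  ∃ Y Z : Matrix (Fin n) (Fin n) ℝ,
    IsFlMul flh Qᵀ A Y ∧ IsFlMul flh Y Q Z ∧ IsSymmetrization (Z.map fl) B

/-! ## The Jacobi algorithm in floating-point arithmetic -/

/-- Computed `ζ = (b - a) / (2c)` for the pivot block `[[a, c], [c, b]]`. -/
def jacobiZeta (fl : ℝ → ℝ) (a b c : ℝ) : ℝ :=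
  fl (fl (b - a) / fl (2 * c))

/-- Computed tangent `t = sign(ζ) / (|ζ| + √(1 + ζ²))` of the rotation angle, with
`sign(0) = 1`. -/
def jacobiTan (fl : ℝ → ℝ) (a b c : ℝ) : ℝ :=
  fl ((if 0 ≤ jacobiZeta fl a b c then 1 else -1) /
    fl (|jacobiZeta fl a b c| +
      fl √(fl (1 + fl (jacobiZeta fl a b c * jacobiZeta fl a b c)))))

/-- Computed cosine `1 / √(1 + t²)`. -/
def jacobiCos (fl : ℝ → ℝ) (a b c : ℝ) : ℝ :=
  fl (1 / fl √(fl (1 + fl (jacobiTan fl a b c * jacobiTan fl a b c))))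

/-- Computed sine `cos * t`. -/
def jacobiSin (fl : ℝ → ℝ) (a b c : ℝ) : ℝ :=
  fl (jacobiCos fl a b c * jacobiTan fl a b c)

/-- One computed two-sided Jacobi rotation of the symmetric matrix `H` with pivot `(i, j)`. In exact
arithmetic this is `Jᵀ H J`, where `J` is the plane rotation that annihilates the entry `(i, j)`.
Nothing is done if that entry is zero already. -/
def jacobiRotate {n : ℕ} (fl : ℝ → ℝ) (H : Matrix (Fin n) (Fin n) ℝ) (i j : Fin n) :
    Matrix (Fin n) (Fin n) ℝ :=
  open Classical in
  let t := jacobiTan fl (H i i) (H j j) (H i j)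
  let cs := jacobiCos fl (H i i) (H j j) (H i j)
  let sn := jacobiSin fl (H i i) (H j j) (H i j)
  let rowI : Fin n → ℝ := fun k => fl (fl (cs * H i k) - fl (sn * H j k))
  let rowJ : Fin n → ℝ := fun k => fl (fl (sn * H i k) + fl (cs * H j k))
  if H i j = 0 then H else
    Matrix.of fun r s =>
      if r = i ∧ s = i then fl (H i i - fl (H i j * t))
      else if r = j ∧ s = j then fl (H j j + fl (H i j * t))
      else if (r = i ∧ s = j) ∨ (r = j ∧ s = i) then 0
      else if r = i then rowI s
      else if r = j then rowJ s
      else if s = i then rowI r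
      else if s = j then rowJ r
      else H r s

/-- The matrix after `m` computed rotations, with pivots `piv 0, …, piv (m - 1)`. -/
def jacobiIterate {n : ℕ} (fl : ℝ → ℝ) (piv : ℕ → Fin n × Fin n)
    (H : Matrix (Fin n) (Fin n) ℝ) : ℕ → Matrix (Fin n) (Fin n) ℝ
  | 0 => H
  | m + 1 => jacobiRotate fl (jacobiIterate fl piv H m) (piv m).1 (piv m).2

/-- The stopping criterion `|h_ij| ≤ tol √(h_ii h_jj)` for all `i ≠ j`, evaluated in floating-point
arithmetic. -/
def JacobiStop {n : ℕ} (fl : ℝ → ℝ) (tol : ℝ) (H : Matrix (Fin n) (Fin n) ℝ) : Prop :=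
  ∀ i j, i ≠ j → |H i j| ≤ fl (tol * fl √(fl (H i i * H j j)))

/-- The Jacobi algorithm, run on `H` with the pivots `piv`, stops after `M` rotations. -/
def IsJacobiRun {n : ℕ} (fl : ℝ → ℝ) (tol : ℝ) (H : Matrix (Fin n) (Fin n) ℝ)
    (piv : ℕ → Fin n × Fin n) (M : ℕ) : Prop :=
  (∀ m < M, (piv m).1 < (piv m).2) ∧ JacobiStop fl tol (jacobiIterate fl piv H M)

/-- The `k`-th largest eigenvalue computed by the run: the `k`-th largest diagonal entry of the
final matrix. -/
def jacobiEig {n : ℕ} (fl : ℝ → ℝ) (H : Matrix (Fin n) (Fin n) ℝ)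
    (piv : ℕ → Fin n × Fin n) (M : ℕ) (k : Fin n) : ℝ :=
  let d : Fin n → ℝ := fun i => jacobiIterate fl piv H M i i
  d (Tuple.sort d k.rev)

end

/-!
The computed eigenvalues pass through four stages, and each stage perturbs the quadratic form of a
positive definite matrix *relatively*. If `|xᵀ B x - (J x)ᵀ A (J x)| ≤ η (J x)ᵀ A (J x)` for all `x`
and `J` is an isometry up to the relative error `p`, then min-max gives
`(1 - η) (1 - p) λₖ(A) ≤ λₖ(B) ≤ (1 + η) (1 + p) λₖ(A)`
(`IsSortedSpectrum.relative_perturbation`).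

* Congruence with the nearly orthogonal `Q` is Ostrowski's theorem, with `p = p₁ u`
  (`eigDesc_congr_bounds`).
* Forming `Qᵀ A Q` in floating-point arithmetic has entrywise errors of size
  `(u + 4 γ α) √(ã_ii ã_jj)` (`IsComputedPrecond.error_le`). Scaled by the diagonal, this is a
  relative perturbation of size `n (u + 4 γ α) κ₂ˢ(Ã)`, which is half of the second term of the
  bound; hence the computed matrix is still positive definite.
* A computed Jacobi rotation is, up to a relative perturbation `O(u κ₂ˢ(H))` of the form, the exact
  rotation with the computed tangent (`jacobiRotate_form_error`). The constant does not depend on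
  the dimension: the errors sit in two rows, whose scaled norms are at most `√λ₁`, and the scaled matrix
  has unit diagonal, so `√λ₁ ≤ λ₁`. The rotation mixes rows of different scale harmlessly because
  its tangent is at most a multiple of the ratio of the scales (`abs_tan_mul_le`). Since there are
  `O(n²)` rotations, the accumulated error is quadratic in `n`.
* When the stopping criterion holds, the matrix differs from its diagonal by a relative
  perturbation of size `2 n tol = O(n² u)` (`jacobiStop_eig_bounds`).

All constants are absorbed in the quadratic polynomial, which is chosen so large that the last two
stages contribute at most a tenth of the first term; this leaves room for the cross terms
(`abs_sub_div_le_of_factors`).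
-/

/-! ### Spectra and the min-max comparison of quadratic forms -/

/-- `l` is the decreasingly ordered spectrum, with multiplicity, of the quadratic form of `A`:
in suitable orthonormal coordinates `C` the form is `∑ k, l k * (C x k) ^ 2`. -/
def IsSortedSpectrum {n : ℕ} (A : Matrix (Fin n) (Fin n) ℝ) (l : Fin n → ℝ) : Prop :=
  Antitone l ∧ ∃ C : (Fin n → ℝ) →ₗ[ℝ] (Fin n → ℝ),
    (∀ x, C x ⬝ᵥ C x = x ⬝ᵥ x) ∧ ∀ x, x ⬝ᵥ A *ᵥ x = ∑ k, l k * (C x k) ^ 2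

theorem dotProduct_self_eq_sum_sq {n : ℕ} (x : Fin n → ℝ) : x ⬝ᵥ x = ∑ k, x k ^ 2 := by
  simp [dotProduct, sq]

theorem dotProduct_self_pos {n : ℕ} {x : Fin n → ℝ} (hx : x ≠ 0) : 0 < x ⬝ᵥ x := by
  rw [dotProduct_self_eq_sum_sq]
  obtain ⟨i, hi⟩ := Function.ne_iff.mp hx
  exact Finset.sum_pos' (fun _ _ => sq_nonneg _) ⟨i, Finset.mem_univ _, by simp at hi; positivity⟩

theorem dotProduct_mulVec_pos {n : ℕ} {A : Matrix (Fin n) (Fin n) ℝ} (hA : A.PosDef)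
    {x : Fin n → ℝ} (hx : x ≠ 0) : 0 < x ⬝ᵥ A *ᵥ x := by
  simpa using hA.dotProduct_mulVec_pos hx

theorem dotProduct_mulVec_nonneg {n : ℕ} {A : Matrix (Fin n) (Fin n) ℝ} (hA : A.PosDef)
    (x : Fin n → ℝ) : 0 ≤ x ⬝ᵥ A *ᵥ x := by
  simpa using hA.posSemidef.dotProduct_mulVec_nonneg x

theorem posDef_of_forall_pos {n : ℕ} {A : Matrix (Fin n) (Fin n) ℝ} (hA : A.IsHermitian)
    (h : ∀ x : Fin n → ℝ, x ≠ 0 → 0 < x ⬝ᵥ A *ᵥ x) : A.PosDef :=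
  .of_dotProduct_mulVec_pos hA fun x hx => by simpa using h x hx

/-- Every sorted eigenvalue is the value of the quadratic form at some unit vector. -/
theorem IsSortedSpectrum.exists_unit {n : ℕ} {A : Matrix (Fin n) (Fin n) ℝ} {a : Fin n → ℝ}
    (hA : IsSortedSpectrum A a) (k : Fin n) : ∃ x, x ⬝ᵥ x = 1 ∧ x ⬝ᵥ A *ᵥ x = a k := by
  obtain ⟨-, C, hC, hCA⟩ := hA
  have hinj : Function.Injective C := by
    rw [injective_iff_map_eq_zero]
    intro x hx
    by_contra h
    have := hC x
    simp [hx] at this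
    exact (dotProduct_self_pos h).ne this
  obtain ⟨x, hx⟩ := LinearMap.injective_iff_surjective.mp hinj (Pi.single k 1)
  refine ⟨x, ?_, ?_⟩
  · rw [← hC, hx]; simp
  · rw [hCA, hx]; simp [Pi.single_apply]

theorem IsSortedSpectrum.pos {n : ℕ} {A : Matrix (Fin n) (Fin n) ℝ} {a : Fin n → ℝ}
    (hA : IsSortedSpectrum A a) (hpos : ∀ x : Fin n → ℝ, x ≠ 0 → 0 < x ⬝ᵥ A *ᵥ x) (k : Fin n) :
    0 < a k := by
  obtain ⟨x, hx1, hx2⟩ := hA.exists_unit k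
  rw [← hx2]
  exact hpos x (by rintro rfl; simp at hx1)

/-- Courant–Fischer comparison. A dimension count gives a nonzero `x` in the span of the top
`k + 1` eigendirections of `B` whose image `P x` lies in the span of the eigendirections of `A` with
index at least `k`; the two forms are compared there. -/
theorem IsSortedSpectrum.le_mul {n : ℕ} {A B : Matrix (Fin n) (Fin n) ℝ} {a b : Fin n → ℝ}
    (hA : IsSortedSpectrum A a) (hB : IsSortedSpectrum B b)
    (P : (Fin n → ℝ) →ₗ[ℝ] (Fin n → ℝ)) {r c : ℝ} (hr : 0 ≤ r) (k : Fin n) (hk : 0 ≤ a k)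
    (h : ∀ x, x ⬝ᵥ B *ᵥ x ≤ r * (P x ⬝ᵥ A *ᵥ P x)) (hP : ∀ x, P x ⬝ᵥ P x ≤ c * (x ⬝ᵥ x)) :
    b k ≤ r * c * a k := by
  obtain ⟨ha, C, hC, hCA⟩ := hA
  obtain ⟨hb, D, hD, hDB⟩ := hB
  -- the `n - 1` linear conditions on `x`; component `k` is zero, so `L` is not surjective
  let L : (Fin n → ℝ) →ₗ[ℝ] (Fin n → ℝ) := LinearMap.pi fun l =>
    if l < k then LinearMap.proj l ∘ₗ C ∘ₗ P
    else if l = k then 0 else LinearMap.proj l ∘ₗ D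
  have hL : ¬ Function.Injective L := by
    rw [LinearMap.injective_iff_surjective]
    intro hs
    obtain ⟨x, hx⟩ := hs (Pi.single k 1)
    have := congrFun hx k
    simp [L] at this
  rw [injective_iff_map_eq_zero] at hL
  push Not at hL
  obtain ⟨x, hx, hx0⟩ := hL
  have h1 : ∀ l, l < k → C (P x) l = 0 := fun l hl => by
    have := congrFun hx l
    simpa [L, hl] using this
  have h2 : ∀ l, k < l → D x l = 0 := fun l hl => by
    have := congrFun hx l
    simpa [L, hl.ne', not_lt.mpr hl.le] using this
  have h3 : b k * (x ⬝ᵥ x) ≤ x ⬝ᵥ B *ᵥ x := by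
    rw [hDB, ← hD, dotProduct_self_eq_sum_sq, Finset.mul_sum]
    refine Finset.sum_le_sum fun l _ => ?_
    rcases lt_or_ge k l with hl | hl
    · simp [h2 l hl]
    · exact mul_le_mul_of_nonneg_right (hb hl) (sq_nonneg _)
  have h4 : P x ⬝ᵥ A *ᵥ P x ≤ a k * (P x ⬝ᵥ P x) := by
    rw [hCA, ← hC, dotProduct_self_eq_sum_sq, Finset.mul_sum]
    refine Finset.sum_le_sum fun l _ => ?_
    rcases lt_or_ge l k with hl | hl
    · simp [h1 l hl]
    · exact mul_le_mul_of_nonneg_right (ha hl) (sq_nonneg _)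
  have hxx := dotProduct_self_pos hx0
  have h5 : b k * (x ⬝ᵥ x) ≤ (r * c * a k) * (x ⬝ᵥ x) :=
    calc b k * (x ⬝ᵥ x) ≤ r * (a k * (c * (x ⬝ᵥ x))) :=
          h3.trans ((h x).trans (mul_le_mul_of_nonneg_left
            (h4.trans (mul_le_mul_of_nonneg_left (hP x) hk)) hr))
      _ = _ := by ring
  exact le_of_mul_le_mul_right h5 hxx

/-- Multiplicative perturbation theory: if the form of `B` is that of `A`, transported by a linear
isomorphism `J` that is isometric up to the relative error `p`, up to the relative error `η`, then
the sorted eigenvalues agree up to the factors `(1 ± η) (1 ± p)`. With `η = 0` this is Ostrowski's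
theorem. -/
theorem IsSortedSpectrum.relative_perturbation {n : ℕ} {A B : Matrix (Fin n) (Fin n) ℝ}
    {a b : Fin n → ℝ} (hA : IsSortedSpectrum A a) (hB : IsSortedSpectrum B b) (hpos : A.PosDef)
    (J : (Fin n → ℝ) ≃ₗ[ℝ] (Fin n → ℝ)) {η p : ℝ} (hη0 : 0 ≤ η) (hη : η < 1) (hp : p < 1)
    (h : ∀ x, |x ⬝ᵥ B *ᵥ x - J x ⬝ᵥ A *ᵥ J x| ≤ η * (J x ⬝ᵥ A *ᵥ J x))
    (hJ : ∀ x, |J x ⬝ᵥ J x - x ⬝ᵥ x| ≤ p * (x ⬝ᵥ x)) (k : Fin n) :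
    b k ≤ (1 + η) * (1 + p) * a k ∧ (1 - η) * (1 - p) * a k ≤ b k := by
  have hak : 0 < a k := hA.pos (fun x hx => dotProduct_mulVec_pos hpos hx) k
  have hbk : 0 < b k := hB.pos (fun x hx => by
    have h1 : 0 < J x ⬝ᵥ A *ᵥ J x := dotProduct_mulVec_pos hpos (by simpa using hx)
    have h2 := (abs_le.mp (h x)).1
    nlinarith) k
  refine ⟨hA.le_mul hB J.toLinearMap (by linarith) k hak.le (fun x => ?_) (fun x => ?_), ?_⟩
  · have := (abs_le.mp (h x)).2
    simp only [LinearEquiv.coe_coe]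
    linarith
  · have := (abs_le.mp (hJ x)).2
    simp only [LinearEquiv.coe_coe]
    linarith
  have h1 : 0 < 1 - η := by linarith
  have h2 : 0 < 1 - p := by linarith
  have h3 : a k ≤ (1 - η)⁻¹ * (1 - p)⁻¹ * b k := by
    refine hB.le_mul hA J.symm.toLinearMap (by positivity) k hbk.le (fun y => ?_) (fun y => ?_)
    · have := (abs_le.mp (h (J.symm y))).1
      simp only [LinearEquiv.coe_coe, LinearEquiv.apply_symm_apply] at this ⊢
      rw [le_inv_mul_iff₀ h1]
      linarith
    · have := (abs_le.mp (hJ (J.symm y))).1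
      simp only [LinearEquiv.coe_coe, LinearEquiv.apply_symm_apply] at this ⊢
      rw [le_inv_mul_iff₀ h2]
      linarith
  calc (1 - η) * (1 - p) * a k
      ≤ (1 - η) * (1 - p) * ((1 - η)⁻¹ * (1 - p)⁻¹ * b k) := by gcongr
    _ = b k := by field_simp

theorem isSortedSpectrum_eigDesc {n : ℕ} {A : Matrix (Fin n) (Fin n) ℝ} (hA : A.IsHermitian) :
    IsSortedSpectrum A (eigDesc A) := by
  have hl : eigDesc A = fun k => hA.eigenvalues₀ (Fin.cast (Fintype.card_fin n).symm k) := by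
    funext k
    exact dif_pos hA
  obtain ⟨b, hb⟩ : ∃ b : OrthonormalBasis (Fin n) ℝ (EuclideanSpace ℝ (Fin n)),
      ∀ k, toEuclideanLin A (b k) = eigDesc A k • b k := by
    refine ⟨((isSymmetric_toEuclideanLin_iff.mpr hA).eigenvectorBasis
      finrank_euclideanSpace).reindex (finCongr (Fintype.card_fin n)), fun k => ?_⟩
    rw [OrthonormalBasis.reindex_apply, LinearMap.IsSymmetric.apply_eigenvectorBasis, hl]
    rfl
  refine ⟨?_, ?_⟩
  · rw [hl]
    intro i j hij
    exact hA.eigenvalues₀_antitone (by simpa using hij)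
  let e := WithLp.linearEquiv 2 ℝ (Fin n → ℝ)
  refine ⟨e.toLinearMap ∘ₗ b.repr.toLinearEquiv.toLinearMap ∘ₗ e.symm.toLinearMap, ?_, ?_⟩
  · intro x
    have h1 : ∀ y z : EuclideanSpace ℝ (Fin n), inner ℝ y z = e z ⬝ᵥ e y := fun y z => by
      simp [e, EuclideanSpace.inner_eq_star_dotProduct]
    have h2 := b.repr.inner_map_map (e.symm x) (e.symm x)
    rw [h1, h1] at h2
    simpa using h2
  · intro x
    have h1 : x ⬝ᵥ A *ᵥ x = inner ℝ (e.symm x) (toEuclideanLin A (e.symm x)) := by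
      rw [EuclideanSpace.inner_eq_star_dotProduct]
      simp [e, toLpLin_apply, dotProduct_comm]
    have hsym := isSymmetric_toEuclideanLin_iff.mpr hA
    rw [h1, ← b.repr.inner_map_map, PiLp.inner_apply]
    refine Finset.sum_congr rfl fun k _ => ?_
    have h2 : b.repr (toEuclideanLin A (e.symm x)) k = eigDesc A k * b.repr (e.symm x) k := by
      rw [b.repr_apply_apply, b.repr_apply_apply, ← hsym, hb, inner_smul_left]
      simp
    rw [h2]
    simp [e]
    ring

/-- The sorted spectrum of a diagonal matrix is its sorted diagonal. -/
theorem isSortedSpectrum_diagonal {n : ℕ} (d : Fin n → ℝ) :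
    IsSortedSpectrum (diagonal d) (fun k => d (Tuple.sort d k.rev)) := by
  refine ⟨fun i j hij => Tuple.monotone_sort d (Fin.rev_le_rev.mpr hij), ?_⟩
  let σ : Equiv.Perm (Fin n) := Fin.revPerm.trans (Tuple.sort d)
  refine ⟨LinearMap.funLeft ℝ ℝ σ, fun x => ?_, fun x => ?_⟩
  · rw [dotProduct_self_eq_sum_sq, dotProduct_self_eq_sum_sq]
    exact Equiv.sum_comp σ (fun i => x i ^ 2)
  · have h1 : x ⬝ᵥ diagonal d *ᵥ x = ∑ i, d i * x i ^ 2 := by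
      simp only [dotProduct, mulVec_diagonal]
      exact Finset.sum_congr rfl fun i _ => by ring
    rw [h1]
    exact (Equiv.sum_comp σ (fun i => d i * x i ^ 2)).symm

/-! ### Diagonal scaling -/

theorem dotProduct_conj {n : ℕ} (A P : Matrix (Fin n) (Fin n) ℝ) (x : Fin n → ℝ) :
    x ⬝ᵥ (Pᵀ * A * P) *ᵥ x = (P *ᵥ x) ⬝ᵥ A *ᵥ (P *ᵥ x) := by
  rw [← mulVec_mulVec, ← mulVec_mulVec, dotProduct_mulVec, vecMul_transpose]

theorem diag_pos_of_posDef {n : ℕ} {H : Matrix (Fin n) (Fin n) ℝ} (hH : H.PosDef) (i : Fin n) :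
    0 < H i i := hH.diag_pos

theorem symm_apply_of_posDef {n : ℕ} {H : Matrix (Fin n) (Fin n) ℝ} (hH : H.PosDef)
    (i j : Fin n) : H j i = H i j := by
  simpa using hH.isHermitian.apply i j

theorem dotProduct_mulVec_sub_single {n : ℕ} {H : Matrix (Fin n) (Fin n) ℝ} (hH : H.PosDef)
    (v : Fin n → ℝ) (t : ℝ) (i : Fin n) :
    (v - Pi.single i t) ⬝ᵥ H *ᵥ (v - Pi.single i t) =
      v ⬝ᵥ H *ᵥ v - 2 * t * (H *ᵥ v) i + t ^ 2 * H i i := by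
  have h1 : v ⬝ᵥ H *ᵥ Pi.single i t = t * (H *ᵥ v) i := by
    have hT : Hᵀ = H := by
      ext k l
      exact symm_apply_of_posDef hH k l
    rw [dotProduct_mulVec, dotProduct_single, ← mulVec_transpose, hT, mul_comm]
  have h2 : (Pi.single i t : Fin n → ℝ) ⬝ᵥ H *ᵥ Pi.single i t = t ^ 2 * H i i := by
    simp
    ring
  rw [mulVec_sub, sub_dotProduct, dotProduct_sub, dotProduct_sub, h1, h2, single_dotProduct]
  ring

theorem abs_apply_le_sqrt {n : ℕ} {H : Matrix (Fin n) (Fin n) ℝ} (hH : H.PosDef) (i j : Fin n) :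
    |H i j| ≤ √(H i i) * √(H j j) := by
  rw [← Real.sqrt_mul (diag_pos_of_posDef hH i).le]
  refine Real.abs_le_sqrt ?_
  have h := dotProduct_mulVec_nonneg hH (Pi.single j (H i i) - Pi.single i (H i j))
  rw [dotProduct_mulVec_sub_single hH] at h
  have h1 : (Pi.single j (H i i) : Fin n → ℝ) ⬝ᵥ H *ᵥ Pi.single j (H i i) =
      H i i ^ 2 * H j j := by
    simp
    ring
  have h2 : (H *ᵥ Pi.single j (H i i)) i = H i j * H i i := by simp [mulVec]
  rw [h1, h2] at h
  have h3 := diag_pos_of_posDef hH i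
  have h4 : 0 ≤ H i i * (H i i * H j j - H i j ^ 2) := by nlinarith
  linarith [nonneg_of_mul_nonneg_right h4 h3]

/-- `lo ≤ 1 ≤ hi` are positive bounds for the spectrum of the diagonally scaled matrix, stated
through the quadratic form of `H` itself. -/
structure ScaledBounds {n : ℕ} (H : Matrix (Fin n) (Fin n) ℝ) (lo hi : ℝ) : Prop where
  lo_pos : 0 < lo
  lo_le : lo ≤ 1
  le_hi : 1 ≤ hi
  le_form : ∀ y, lo * ∑ k, H k k * y k ^ 2 ≤ y ⬝ᵥ H *ᵥ y
  form_le : ∀ y, y ⬝ᵥ H *ᵥ y ≤ hi * ∑ k, H k k * y k ^ 2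

theorem exists_scaledBounds {n : ℕ} (hn : 0 < n) {H : Matrix (Fin n) (Fin n) ℝ} (hH : H.PosDef) :
    ∃ lo hi, ScaledBounds H lo hi ∧ scaledCond2 H = hi / lo := by
  set D : Matrix (Fin n) (Fin n) ℝ := diagonal (fun i => 1 / √(H i i)) with hD
  have hd : ∀ i, 0 < √(H i i) := fun i => Real.sqrt_pos.mpr (diag_pos_of_posDef hH i)
  have hform : ∀ x, x ⬝ᵥ (D * H * D) *ᵥ x = (D *ᵥ x) ⬝ᵥ H *ᵥ (D *ᵥ x) := fun x => by
    have h := dotProduct_conj H D x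
    rwa [hD, diagonal_transpose, ← hD] at h
  have hherm : (D * H * D).IsHermitian := by
    have h := isHermitian_conjTranspose_mul_mul D hH.isHermitian
    rwa [hD, diagonal_conjTranspose, star_trivial, ← hD] at h
  have hsp := isSortedSpectrum_eigDesc hherm
  have hscale : ∀ y : Fin n → ℝ, ∃ z : Fin n → ℝ, D *ᵥ z = y ∧
      z ⬝ᵥ z = ∑ k, H k k * y k ^ 2 := fun y => by
    refine ⟨fun k => √(H k k) * y k, ?_, ?_⟩
    · ext k
      rw [hD, mulVec_diagonal]
      field_simp [(hd k).ne']
    · rw [dotProduct_self_eq_sum_sq]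
      refine Finset.sum_congr rfl fun k _ => ?_
      rw [mul_pow, Real.sq_sqrt (diag_pos_of_posDef hH k).le]
  set lo := eigDesc (D * H * D) ⟨n - 1, Nat.sub_lt hn one_pos⟩ with hlo
  set hi := eigDesc (D * H * D) ⟨0, hn⟩ with hhi
  have hanti := hsp.1
  have hpos : 0 < lo := hsp.pos (fun x hx => by
    rw [hform]
    refine dotProduct_mulVec_pos hH fun h => hx ?_
    ext k
    have h1 := congrFun h k
    rw [hD, mulVec_diagonal] at h1
    simpa [(hd k).ne'] using h1) _
  have h1 : ∀ y, lo * ∑ k, H k k * y k ^ 2 ≤ y ⬝ᵥ H *ᵥ y := fun y => by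
    obtain ⟨z, hz, hzz⟩ := hscale y
    obtain ⟨-, C, hC, hCA⟩ := hsp
    rw [← hzz, ← hz, ← hform, hCA, ← hC, dotProduct_self_eq_sum_sq, Finset.mul_sum]
    refine Finset.sum_le_sum fun k _ => mul_le_mul_of_nonneg_right (hanti ?_) (sq_nonneg _)
    exact Fin.le_def.mpr (Nat.le_sub_one_of_lt k.2)
  have h2 : ∀ y, y ⬝ᵥ H *ᵥ y ≤ hi * ∑ k, H k k * y k ^ 2 := fun y => by
    obtain ⟨z, hz, hzz⟩ := hscale y
    obtain ⟨-, C, hC, hCA⟩ := hsp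
    rw [← hzz, ← hz, ← hform, hCA, ← hC, dotProduct_self_eq_sum_sq, Finset.mul_sum]
    refine Finset.sum_le_sum fun k _ => mul_le_mul_of_nonneg_right (hanti ?_) (sq_nonneg _)
    exact Fin.le_def.mpr (Nat.zero_le _)
  have h3 : (Pi.single ⟨0, hn⟩ 1 : Fin n → ℝ) ⬝ᵥ H *ᵥ Pi.single ⟨0, hn⟩ 1 = H ⟨0, hn⟩ ⟨0, hn⟩ := by
    simp
  have h4 : ∑ k, H k k * (Pi.single ⟨0, hn⟩ 1 : Fin n → ℝ) k ^ 2 = H ⟨0, hn⟩ ⟨0, hn⟩ := by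
    simp [Pi.single_apply]
  have h5 := diag_pos_of_posDef hH ⟨0, hn⟩
  have h6 := h1 (Pi.single ⟨0, hn⟩ 1)
  have h7 := h2 (Pi.single ⟨0, hn⟩ 1)
  rw [h3, h4] at h6 h7
  refine ⟨lo, hi, ⟨hpos, ?_, ?_, h1, h2⟩, ?_⟩
  · nlinarith
  · nlinarith
  · rw [scaledCond2, cond2, dif_pos hn]

theorem one_le_scaledCond2 {n : ℕ} (hn : 0 < n) {H : Matrix (Fin n) (Fin n) ℝ} (hH : H.PosDef) :
    1 ≤ scaledCond2 H := by
  obtain ⟨lo, hi, hb, h⟩ := exists_scaledBounds hn hH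
  rw [h, one_le_div hb.lo_pos]
  exact hb.lo_le.trans hb.le_hi

/-- The scaled squared diagonal norm of a vector is controlled by its energy. -/
theorem sum_diag_mul_sq_le {n : ℕ} (hn : 0 < n) {H : Matrix (Fin n) (Fin n) ℝ} (hH : H.PosDef)
    (y : Fin n → ℝ) : ∑ k, H k k * y k ^ 2 ≤ scaledCond2 H * (y ⬝ᵥ H *ᵥ y) := by
  obtain ⟨lo, hi, hb, h⟩ := exists_scaledBounds hn hH
  have h1 := hb.le_form y
  rw [h, div_mul_eq_mul_div, le_div_iff₀ hb.lo_pos]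
  have h2 := dotProduct_mulVec_nonneg hH y
  nlinarith [hb.le_hi]

/-- Squared row norms of the scaled matrix are at most its largest eigenvalue: expand
`(v - hi eᵢ)ᵀ H (v - hi eᵢ) ≥ 0` for `v k = h i k / h k k`. -/
theorem ScaledBounds.sum_row_sq_le {n : ℕ} {H : Matrix (Fin n) (Fin n) ℝ} {lo hi : ℝ}
    (hb : ScaledBounds H lo hi) (hH : H.PosDef) (i : Fin n) :
    ∑ k, H i k ^ 2 / H k k ≤ hi * H i i := by
  set v : Fin n → ℝ := fun k => H i k / H k k with hv
  have hd : ∀ k, H k k ≠ 0 := fun k => (diag_pos_of_posDef hH k).ne'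
  have h := dotProduct_mulVec_nonneg hH (v - Pi.single i hi)
  rw [dotProduct_mulVec_sub_single hH] at h
  have h1 : (H *ᵥ v) i = ∑ k, H i k ^ 2 / H k k := by
    simp only [mulVec, dotProduct, hv]
    exact Finset.sum_congr rfl fun k _ => by ring
  have h2 : ∑ k, H k k * v k ^ 2 = ∑ k, H i k ^ 2 / H k k := by
    refine Finset.sum_congr rfl fun k _ => ?_
    simp only [hv]
    field_simp [hd k]
  have h3 := hb.form_le v
  rw [h2] at h3
  rw [h1] at h
  have h4 : 0 ≤ hi * (hi * H i i - ∑ k, H i k ^ 2 / H k k) := by nlinarith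
  have h5 : 0 < hi := by linarith [hb.le_hi]
  linarith [nonneg_of_mul_nonneg_right h4 h5]

theorem ScaledBounds.sum_abs_row_sq_le {n : ℕ} {H : Matrix (Fin n) (Fin n) ℝ} {lo hi : ℝ}
    (hb : ScaledBounds H lo hi) (hH : H.PosDef) (i : Fin n) (y : Fin n → ℝ) :
    (∑ k, |H i k| * |y k|) ^ 2 ≤ hi * H i i * ∑ k, H k k * y k ^ 2 := by
  have hd : ∀ k, 0 < H k k := fun k => diag_pos_of_posDef hH k
  have h1 : ∑ k, |H i k| * |y k| = ∑ k, (|H i k| / √(H k k)) * (√(H k k) * |y k|) := by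
    refine Finset.sum_congr rfl fun k _ => ?_
    field_simp [(Real.sqrt_pos.mpr (hd k)).ne']
  rw [h1]
  refine (Finset.sum_mul_sq_le_sq_mul_sq _ _ _).trans ?_
  have h2 : ∑ k, (|H i k| / √(H k k)) ^ 2 = ∑ k, H i k ^ 2 / H k k :=
    Finset.sum_congr rfl fun k _ => by rw [div_pow, sq_abs, Real.sq_sqrt (hd k).le]
  have h3 : ∑ k, (√(H k k) * |y k|) ^ 2 = ∑ k, H k k * y k ^ 2 :=
    Finset.sum_congr rfl fun k _ => by rw [mul_pow, sq_abs, Real.sq_sqrt (hd k).le]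
  rw [h2, h3]
  exact mul_le_mul_of_nonneg_right (hb.sum_row_sq_le hH i)
    (Finset.sum_nonneg fun k _ => mul_nonneg (hd k).le (sq_nonneg _))

/-- An entrywise bound relative to `√(h i i) √(h j j)` becomes a bound of quadratic forms. -/
theorem abs_form_le_of_abs_apply_le {n : ℕ} {E : Matrix (Fin n) (Fin n) ℝ} {d : Fin n → ℝ}
    (hd : ∀ i, 0 ≤ d i) {ε : ℝ} (hε : 0 ≤ ε) (h : ∀ i j, |E i j| ≤ ε * (√(d i) * √(d j)))
    (x : Fin n → ℝ) : |x ⬝ᵥ E *ᵥ x| ≤ ε * n * ∑ k, d k * x k ^ 2 := by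
  have h1 : |x ⬝ᵥ E *ᵥ x| ≤ ε * (∑ i, √(d i) * |x i|) ^ 2 := by
    simp only [dotProduct, mulVec]
    refine (Finset.abs_sum_le_sum_abs _ _).trans ?_
    rw [sq, Finset.sum_mul, Finset.mul_sum]
    refine Finset.sum_le_sum fun i _ => ?_
    rw [abs_mul, Finset.mul_sum, Finset.mul_sum]
    refine (mul_le_mul_of_nonneg_left (Finset.abs_sum_le_sum_abs _ _) (abs_nonneg _)).trans ?_
    rw [Finset.mul_sum]
    refine Finset.sum_le_sum fun j _ => ?_
    rw [abs_mul]
    calc |x i| * (|E i j| * |x j|) ≤ |x i| * (ε * (√(d i) * √(d j)) * |x j|) := by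
          gcongr
          exact h i j
      _ = _ := by ring
  refine h1.trans ?_
  rw [mul_assoc]
  refine mul_le_mul_of_nonneg_left ?_ hε
  have h2 := sq_sum_le_card_mul_sum_sq (s := Finset.univ) (f := fun i => √(d i) * |x i|)
  simpa [mul_pow, Real.sq_sqrt, hd] using h2

/-! ### Rounding errors of sums and products -/

theorem IsFlSum.nonempty {ι : Type} [DecidableEq ι] {fl : ℝ → ℝ} {f : ι → ℝ} {s : Finset ι}
    {x : ℝ} (h : IsFlSum fl f s x) : s.Nonempty := by
  induction h with
  | single i => exact Finset.singleton_nonempty i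
  | add s t x y hst hx hy ihx ihy => exact ihx.mono Finset.subset_union_left

/-- A sum of `m` terms, evaluated with any bracketing, carries at most `m - 1` rounding factors on
each term. -/
theorem IsFlSum.error_le {ι : Type} [DecidableEq ι] {fl : ℝ → ℝ} {f : ι → ℝ} {s : Finset ι}
    {x u : ℝ} (hu : 0 ≤ u) (hfl : IsRounding u fl) (h : IsFlSum fl f s x) :
    |x - ∑ i ∈ s, f i| ≤ ((1 + u) ^ (s.card - 1) - 1) * ∑ i ∈ s, |f i| := by
  induction h with
  | single i => simp
  | add s t x y hst hx hy ihx ihy =>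
    have hs := hx.nonempty.card_pos
    have ht := hy.nonempty.card_pos
    rw [Finset.sum_union hst, Finset.sum_union hst, Finset.card_union_of_disjoint hst]
    have h1 := hfl (x + y)
    have h2 : |fl (x + y) - (∑ i ∈ s, f i + ∑ i ∈ t, f i)| ≤
        |fl (x + y) - (x + y)| + (|x - ∑ i ∈ s, f i| + |y - ∑ i ∈ t, f i|) := by
      have := abs_add_le (fl (x + y) - (x + y)) ((x - ∑ i ∈ s, f i) + (y - ∑ i ∈ t, f i))
      have h3 := abs_add_le (x - ∑ i ∈ s, f i) (y - ∑ i ∈ t, f i)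
      calc _ = |(fl (x + y) - (x + y)) + ((x - ∑ i ∈ s, f i) + (y - ∑ i ∈ t, f i))| := by
            congr 1; ring
        _ ≤ _ := by linarith
    have h3 : |x + y| ≤ (|x - ∑ i ∈ s, f i| + |y - ∑ i ∈ t, f i|) +
        (∑ i ∈ s, |f i| + ∑ i ∈ t, |f i|) := by
      have hx1 := abs_sub_abs_le_abs_sub x (∑ i ∈ s, f i)
      have hy1 := abs_sub_abs_le_abs_sub y (∑ i ∈ t, f i)
      have hx2 := Finset.abs_sum_le_sum_abs f s
      have hy2 := Finset.abs_sum_le_sum_abs f t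
      linarith [abs_add_le x y]
    have key : ∀ a b : ℕ, 0 < a → 0 < b →
        (1 + u) * (1 + u) ^ (a - 1) ≤ (1 + u) ^ (a + b - 1) := fun a b ha hb => by
      rw [← pow_succ']
      exact pow_le_pow_right₀ (by linarith) (by omega)
    have hk1 := key s.card t.card hs ht
    have hk2 := key t.card s.card ht hs
    rw [add_comm t.card] at hk2
    have hS : 0 ≤ ∑ i ∈ s, |f i| := Finset.sum_nonneg fun _ _ => abs_nonneg _
    have hT : 0 ≤ ∑ i ∈ t, |f i| := Finset.sum_nonneg fun _ _ => abs_nonneg _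
    have hm1 := mul_le_mul_of_nonneg_right hk1 hS
    have hm2 := mul_le_mul_of_nonneg_right hk2 hT
    have h4 : u * |x + y| ≤ u * ((|x - ∑ i ∈ s, f i| + |y - ∑ i ∈ t, f i|) +
        (∑ i ∈ s, |f i| + ∑ i ∈ t, |f i|)) := mul_le_mul_of_nonneg_left h3 hu
    have h5 := mul_le_mul_of_nonneg_left ihx (by linarith : 0 ≤ 1 + u)
    have h6 := mul_le_mul_of_nonneg_left ihy (by linarith : 0 ≤ 1 + u)
    linarith

/-- `(1 + u) ^ n - 1 ≤ n u / (1 - n u)`. -/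
theorem one_add_pow_sub_one_le {n : ℕ} {u : ℝ} (hu : 0 ≤ u) (hu1 : u ≤ 1) (hnu : n * u < 1) :
    (1 + u) ^ n - 1 ≤ n * u / (1 - n * u) := by
  have h1 : 1 - n * u ≤ (1 - u) ^ n := by
    have := one_add_mul_le_pow (by linarith : (-2 : ℝ) ≤ -u) n
    rw [← sub_eq_add_neg] at this
    linarith
  have h2 : (1 + u) ^ n * (1 - u) ^ n ≤ 1 := by
    rw [← mul_pow]
    exact pow_le_one₀ (mul_nonneg (by linarith) (by linarith)) (by nlinarith)
  have h3 : (0 : ℝ) < 1 - n * u := by linarith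
  rw [le_div_iff₀ h3]
  have h4 := mul_le_mul_of_nonneg_left h1 (pow_nonneg (by linarith : 0 ≤ 1 + u) n)
  linarith

theorem IsFlMul.error_le {n : ℕ} {fl : ℝ → ℝ} {u : ℝ} {X Y Z : Matrix (Fin n) (Fin n) ℝ}
    (hu : 0 ≤ u) (hu1 : u ≤ 1) (hnu : n * u < 1) (hfl : IsRounding u fl) (h : IsFlMul fl X Y Z)
    (i j : Fin n) :
    |Z i j - (X * Y) i j| ≤ n * u / (1 - n * u) * ∑ k, |X i k| * |Y k j| := by
  have h1 := (h i j).error_le hu hfl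
  have hn : 0 < n := i.pos
  have hγ := one_add_pow_sub_one_le hu hu1 hnu
  set S := ∑ k, |X i k| * |Y k j| with hS
  have hS0 : 0 ≤ S := Finset.sum_nonneg fun _ _ => by positivity
  set q := (1 + u) ^ (Finset.univ.card (α := Fin n) - 1) with hq
  have hq1 : 1 ≤ q := one_le_pow₀ (by linarith)
  have hqn : (1 + u) ^ n = (1 + u) * q := by
    rw [hq, ← pow_succ', Finset.card_univ, Fintype.card_fin, Nat.sub_add_cancel hn]
  have h2 : |∑ k, fl (X i k * Y k j) - (X * Y) i j| ≤ u * S := by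
    rw [mul_apply, ← Finset.sum_sub_distrib, hS, Finset.mul_sum]
    refine (Finset.abs_sum_le_sum_abs _ _).trans (Finset.sum_le_sum fun k _ => ?_)
    rw [← abs_mul]
    exact hfl _
  have h3 : ∑ k, |fl (X i k * Y k j)| ≤ (1 + u) * S := by
    rw [hS, Finset.mul_sum]
    refine Finset.sum_le_sum fun k _ => ?_
    rw [← abs_mul]
    have h4 := hfl (X i k * Y k j)
    have h5 := abs_sub_abs_le_abs_sub (fl (X i k * Y k j)) (X i k * Y k j)
    linarith
  have h4 := mul_le_mul_of_nonneg_left h3 (by linarith : 0 ≤ q - 1)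
  calc |Z i j - (X * Y) i j|
      ≤ |Z i j - ∑ k, fl (X i k * Y k j)| + |∑ k, fl (X i k * Y k j) - (X * Y) i j| :=
        abs_sub_le _ _ _
    _ ≤ ((1 + u) ^ n - 1) * S := by
        rw [hqn]
        linarith
    _ ≤ _ := mul_le_mul_of_nonneg_right hγ hS0

theorem alphaMax_nonneg {n : ℕ} (A Q : Matrix (Fin n) (Fin n) ℝ) : 0 ≤ alphaMax A Q := by
  refine Real.iSup_nonneg fun p => div_nonneg ?_ (Real.sqrt_nonneg _)
  rw [mul_apply]
  refine Finset.sum_nonneg fun k _ => mul_nonneg ?_ (by simp [matAbs])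
  rw [mul_apply]
  exact Finset.sum_nonneg fun l _ => mul_nonneg (by simp [matAbs]) (by simp [matAbs])

theorem matAbs_mul_le_alphaMax {n : ℕ} {A Q : Matrix (Fin n) (Fin n) ℝ}
    (hP : (Qᵀ * A * Q).PosDef) (i j : Fin n) :
    (matAbs Qᵀ * matAbs A * matAbs Q) i j ≤
      alphaMax A Q * (√((Qᵀ * A * Q) i i) * √((Qᵀ * A * Q) j j)) := by
  have hi := diag_pos_of_posDef hP i
  have hj := diag_pos_of_posDef hP j
  rw [← Real.sqrt_mul hi.le, ← div_le_iff₀ (Real.sqrt_pos.mpr (mul_pos hi hj))]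
  exact le_ciSup (f := fun p : Fin n × Fin n => (matAbs Qᵀ * matAbs A * matAbs Q) p.1 p.2 /
    √((Qᵀ * A * Q) p.1 p.1 * (Qᵀ * A * Q) p.2 p.2)) (Set.finite_range _).bddAbove (i, j)

/-! ### The computed preconditioned matrix -/

theorem IsSymmetrization.isHermitian {n : ℕ} {X B : Matrix (Fin n) (Fin n) ℝ}
    (h : IsSymmetrization X B) : B.IsHermitian := by
  rcases h with rfl | ⟨h, -⟩
  · ext i j
    simp
    ring
  · ext i j
    simpa using h.apply i j

theorem IsSymmetrization.error_le {n : ℕ} {X B C : Matrix (Fin n) (Fin n) ℝ}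
    (h : IsSymmetrization X B) (hC : ∀ i j, C j i = C i j) {e : Fin n → Fin n → ℝ}
    (he : ∀ i j, e j i = e i j) (hX : ∀ i j, |X i j - C i j| ≤ e i j) (i j : Fin n) :
    |B i j - C i j| ≤ e i j := by
  have h1 := hX i j
  have h2 := hX j i
  rw [hC i j, he i j] at h2
  rcases h with rfl | ⟨-, h⟩
  · rw [abs_le] at h1 h2 ⊢
    have h3 : ((1 / 2 : ℝ) • (X + Xᵀ)) i j = 1 / 2 * (X i j + X j i) := rfl
    rw [h3]
    constructor <;> linarith [h1.1, h1.2, h2.1, h2.2]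
  · rcases h i j with h | h <;> rw [h] <;> assumption

/-- The two products contribute `γ (2 + γ) |Qᵀ| |A| |Q|`, and the final rounding a factor `1 + u` on
it and `u` on the entry itself; `(1 + u) (2 + γ) ≤ 4`. -/
theorem IsComputedPrecond.error_le {n : ℕ} {fl flh : ℝ → ℝ} {u uh : ℝ}
    {A Q B : Matrix (Fin n) (Fin n) ℝ} (h : IsComputedPrecond fl flh A Q B)
    (huh : 0 ≤ uh) (huh1 : uh ≤ 1) (hnu : n * uh < 1) (hu : u ≤ 1 / 10)
    (hfl : IsRounding u fl) (hflh : IsRounding uh flh) (hγu : n * uh / (1 - n * uh) ≤ u)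
    (hP : (Qᵀ * A * Q).PosDef) (i j : Fin n) :
    |B i j - (Qᵀ * A * Q) i j| ≤
      (u + 4 * (n * uh / (1 - n * uh)) * alphaMax A Q) *
        (√((Qᵀ * A * Q) i i) * √((Qᵀ * A * Q) j j)) := by
  obtain ⟨Y, Z, hY, hZ, hB⟩ := h
  set γ := n * uh / (1 - n * uh) with hγ
  have hγ0 : 0 ≤ γ := div_nonneg (by positivity) (by linarith)
  have hu0 : 0 ≤ u := hγ0.trans hγu
  refine hB.error_le (C := Qᵀ * A * Q)
    (e := fun i j => (u + 4 * γ * alphaMax A Q) *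
        (√((Qᵀ * A * Q) i i) * √((Qᵀ * A * Q) j j)))
    (fun i j => symm_apply_of_posDef hP i j)
    (fun i j => by ring) (fun i j => ?_) i j
  set W := matAbs Qᵀ * matAbs A with hW
  set T := (W * matAbs Q) i j with hT
  have hT0 : T = ∑ k, W i k * |Q k j| := by
    rw [hT, mul_apply]
    rfl
  have hW0 : ∀ k, W i k = ∑ l, |Qᵀ i l| * |A l k| := fun k => by
    rw [hW, mul_apply]
    rfl
  have hY1 : ∀ k, |Y i k - (Qᵀ * A) i k| ≤ γ * W i k := fun k => by
    rw [hW0]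
    exact hY.error_le huh huh1 hnu hflh i k
  have hQA : ∀ k, |(Qᵀ * A) i k| ≤ W i k := fun k => by
    rw [hW0, mul_apply]
    refine (Finset.abs_sum_le_sum_abs _ _).trans (le_of_eq ?_)
    exact Finset.sum_congr rfl fun l _ => abs_mul _ _
  have hWn : ∀ k, 0 ≤ W i k := fun k => (abs_nonneg _).trans (hQA k)
  have hTn : 0 ≤ T := by
    rw [hT0]
    exact Finset.sum_nonneg fun k _ => mul_nonneg (hWn k) (abs_nonneg _)
  have hY2 : ∀ k, |Y i k| ≤ (1 + γ) * W i k := fun k => by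
    have := abs_sub_abs_le_abs_sub (Y i k) ((Qᵀ * A) i k)
    linarith [hY1 k, hQA k]
  have hZ1 : |Z i j - (Y * Q) i j| ≤ γ * ((1 + γ) * T) := by
    refine (hZ.error_le huh huh1 hnu hflh i j).trans (mul_le_mul_of_nonneg_left ?_ hγ0)
    rw [hT0, Finset.mul_sum]
    refine Finset.sum_le_sum fun k _ => ?_
    rw [← mul_assoc]
    exact mul_le_mul_of_nonneg_right (hY2 k) (abs_nonneg _)
  have hZ2 : |(Y * Q) i j - (Qᵀ * A * Q) i j| ≤ γ * T := by
    rw [mul_apply, mul_apply (M := Qᵀ * A), ← Finset.sum_sub_distrib, hT0, Finset.mul_sum]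
    refine (Finset.abs_sum_le_sum_abs _ _).trans (Finset.sum_le_sum fun k _ => ?_)
    rw [← sub_mul, abs_mul, ← mul_assoc]
    exact mul_le_mul_of_nonneg_right (hY1 k) (abs_nonneg _)
  have hZ3 : |Z i j - (Qᵀ * A * Q) i j| ≤ γ * (2 + γ) * T := by
    have := abs_sub_le (Z i j) ((Y * Q) i j) ((Qᵀ * A * Q) i j)
    linarith
  have hZ4 : |Z i j| ≤ |(Qᵀ * A * Q) i j| + γ * (2 + γ) * T := by
    have := abs_sub_abs_le_abs_sub (Z i j) ((Qᵀ * A * Q) i j)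
    linarith
  have h1 : |fl (Z i j) - (Qᵀ * A * Q) i j| ≤
      u * |(Qᵀ * A * Q) i j| + (1 + u) * (γ * (2 + γ) * T) := by
    have h2 := abs_sub_le (fl (Z i j)) (Z i j) ((Qᵀ * A * Q) i j)
    have h3 := hfl (Z i j)
    have h4 := mul_le_mul_of_nonneg_left hZ4 hu0
    linarith
  have h2 : (1 + u) * (γ * (2 + γ) * T) ≤ 4 * γ * T := by
    have h3 : (1 + u) * (2 + γ) ≤ 4 := by nlinarith
    have h4 := mul_le_mul_of_nonneg_right h3 (mul_nonneg hγ0 hTn)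
    linarith
  have h3 := mul_le_mul_of_nonneg_left (abs_apply_le_sqrt hP i j) hu0
  have h4 := mul_le_mul_of_nonneg_left (matAbs_mul_le_alphaMax hP i j)
    (by linarith : 0 ≤ 4 * γ)
  rw [map_apply]
  linarith

/-! ### Relative errors -/

/-- `x'` agrees with `x` up to `k` relative errors of size `u`: `x' = ρ x`, where both `ρ` and
`ρ⁻¹` are at least `(1 - u) ^ k`. -/
def RelClose (u : ℝ) (k : ℕ) (x' x : ℝ) : Prop :=
  ∃ ρ : ℝ, (1 - u) ^ k ≤ ρ ∧ ρ * (1 - u) ^ k ≤ 1 ∧ x' = ρ * x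

namespace RelClose

variable {u : ℝ} {k l : ℕ} {x x' y y' z : ℝ}

theorem refl (u : ℝ) (x : ℝ) : RelClose u 0 x x := ⟨1, by simp, by simp, by simp⟩

theorem mono (hu : 0 ≤ u) (hu1 : u < 1) (h : RelClose u k x' x) (hkl : k ≤ l) :
    RelClose u l x' x := by
  obtain ⟨ρ, h1, h2, h3⟩ := h
  have hq : (1 - u) ^ l ≤ (1 - u) ^ k := pow_le_pow_of_le_one (by linarith) (by linarith) hkl
  have hk : 0 < (1 - u) ^ k := pow_pos (by linarith) k
  exact ⟨ρ, hq.trans h1, (mul_le_mul_of_nonneg_left hq (hk.le.trans h1)).trans h2, h3⟩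

theorem of_rounding {fl : ℝ → ℝ} (hfl : IsRounding u fl) (hu : 0 ≤ u) (hu1 : u < 1) (x : ℝ) :
    RelClose u 1 (fl x) x := by
  have h := hfl x
  rcases eq_or_ne x 0 with rfl | hx
  · refine ⟨1, by simpa using hu, by simpa using hu, ?_⟩
    simpa using h
  have h1 : |fl x / x - 1| ≤ u := by
    rw [div_sub_one hx, abs_div, div_le_iff₀ (abs_pos.mpr hx)]
    exact h
  rw [abs_le] at h1
  refine ⟨fl x / x, by linarith, ?_, by field_simp⟩
  rw [pow_one]
  nlinarith

theorem trans {w : ℝ} (hu1 : u < 1) (h : RelClose u k w y) (h' : RelClose u l y x) :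
    RelClose u (k + l) w x := by
  obtain ⟨ρ, h1, h2, h3⟩ := h
  obtain ⟨σ, h4, h5, h6⟩ := h'
  have hk : 0 < (1 - u) ^ k := pow_pos (by linarith) k
  have hl : 0 < (1 - u) ^ l := pow_pos (by linarith) l
  refine ⟨ρ * σ, ?_, ?_, by rw [h3, h6]; ring⟩
  · rw [pow_add]
    exact mul_le_mul h1 h4 hl.le (hk.le.trans h1)
  · rw [pow_add]
    calc ρ * σ * ((1 - u) ^ k * (1 - u) ^ l) = (ρ * (1 - u) ^ k) * (σ * (1 - u) ^ l) := by ring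
      _ ≤ 1 := mul_le_one₀ h2 (mul_nonneg (hl.le.trans h4) hl.le) h5

theorem fl {fl : ℝ → ℝ} (hfl : IsRounding u fl) (hu : 0 ≤ u) (hu1 : u < 1)
    (h : RelClose u k x' x) : RelClose u (1 + k) (fl x') x :=
  (of_rounding hfl hu hu1 x').trans hu1 h

theorem mul (hu1 : u < 1) (h : RelClose u k x' x) (h' : RelClose u l y' y) :
    RelClose u (k + l) (x' * y') (x * y) := by
  have h1 : RelClose u k (x' * y') (x * y') := by
    obtain ⟨ρ, h1, h2, h3⟩ := h
    exact ⟨ρ, h1, h2, by rw [h3]; ring⟩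
  refine h1.trans hu1 ?_
  obtain ⟨σ, h4, h5, h6⟩ := h'
  exact ⟨σ, h4, h5, by rw [h6]; ring⟩

theorem inv (hu1 : u < 1) (h : RelClose u k x' x) : RelClose u k x'⁻¹ x⁻¹ := by
  obtain ⟨ρ, h1, h2, h3⟩ := h
  have hk : 0 < (1 - u) ^ k := pow_pos (by linarith) k
  have hρ : 0 < ρ := hk.trans_le h1
  refine ⟨ρ⁻¹, ?_, ?_, by rw [h3, mul_inv]⟩
  · rw [← one_div, le_div_iff₀ hρ]
    linarith
  · rw [inv_mul_le_iff₀ hρ]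
    linarith

theorem div (hu1 : u < 1) (h : RelClose u k x' x) (h' : RelClose u l y' y) :
    RelClose u (k + l) (x' / y') (x / y) := by
  rw [div_eq_mul_inv, div_eq_mul_inv]
  exact h.mul hu1 (h'.inv hu1)

theorem sqrt (hu : 0 ≤ u) (hu1 : u < 1) (h : RelClose u k x' x) : RelClose u k (√x') (√x) := by
  obtain ⟨ρ, h1, h2, h3⟩ := h
  have hk : 0 < (1 - u) ^ k := pow_pos (by linarith) k
  have hk1 : (1 - u) ^ k ≤ 1 := pow_le_one₀ (by linarith) (by linarith)
  have hρ : 0 < ρ := hk.trans_le h1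
  refine ⟨√ρ, Real.le_sqrt_of_sq_le (by nlinarith), ?_, by rw [h3, Real.sqrt_mul hρ.le]⟩
  rw [← le_div_iff₀ hk, Real.sqrt_le_left (by positivity), div_pow, one_pow,
    le_div_iff₀ (by positivity)]
  nlinarith

theorem abs (hu1 : u < 1) (h : RelClose u k x' x) : RelClose u k |x'| |x| := by
  obtain ⟨ρ, h1, h2, h3⟩ := h
  have hk : 0 < (1 - u) ^ k := pow_pos (by linarith) k
  exact ⟨ρ, h1, h2, by rw [h3, abs_mul, abs_of_pos (hk.trans_le h1)]⟩

theorem add (hx : 0 ≤ x) (hy : 0 ≤ y) (h : RelClose u k x' x) (h' : RelClose u k y' y) :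
    RelClose u k (x' + y') (x + y) := by
  rcases (add_nonneg hx hy).eq_or_lt with h0 | h0
  · have hx0 : x = 0 := by linarith
    have hy0 : y = 0 := by linarith
    obtain ⟨ρ, h1, h2, h3⟩ := h
    obtain ⟨σ, h4, h5, h6⟩ := h'
    exact ⟨ρ, h1, h2, by simp [h3, h6, hx0, hy0]⟩
  obtain ⟨ρ, h1, h2, h3⟩ := h
  obtain ⟨σ, h4, h5, h6⟩ := h'
  refine ⟨(x' + y') / (x + y), ?_, ?_, by field_simp⟩
  · rw [le_div_iff₀ h0, h3, h6]
    nlinarith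
  · rw [div_mul_eq_mul_div, div_le_iff₀ h0, h3, h6]
    nlinarith

theorem nonneg_iff (hu1 : u < 1) (h : RelClose u k x' x) : 0 ≤ x' ↔ 0 ≤ x := by
  obtain ⟨ρ, h1, h2, h3⟩ := h
  have hk : 0 < (1 - u) ^ k := pow_pos (by linarith) k
  rw [h3]
  exact mul_nonneg_iff_of_pos_left (hk.trans_le h1)

theorem exists_abs_sub_le (hu : 0 ≤ u) (hu1 : u < 1) (hk : k * u ≤ 1 / 2)
    (h : RelClose u k x' x) : ∃ ρ, |ρ - 1| ≤ 2 * k * u ∧ x' = ρ * x := by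
  obtain ⟨ρ, h1, h2, h3⟩ := h
  have h4 : 1 - k * u ≤ (1 - u) ^ k := by
    have := one_add_mul_le_pow (by linarith : (-2 : ℝ) ≤ -u) k
    rw [← sub_eq_add_neg] at this
    linarith
  have h5 : 0 ≤ (k : ℝ) * u := by positivity
  refine ⟨ρ, abs_le.mpr ⟨by linarith, ?_⟩, h3⟩
  nlinarith

theorem abs_sub_le (hu : 0 ≤ u) (hu1 : u < 1) (hk : k * u ≤ 1 / 2)
    (h : RelClose u k x' x) : |x' - x| ≤ 2 * k * u * |x| := by
  obtain ⟨ρ, h1, h2⟩ := h.exists_abs_sub_le hu hu1 hk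
  rw [h2, ← sub_one_mul, abs_mul]
  exact mul_le_mul_of_nonneg_right h1 (abs_nonneg _)

end RelClose

/-! ### The computed rotation -/

/-- `t = sign(ζ) / (|ζ| + √(1 + ζ²))` is the root of `t² + 2 ζ t = 1` of smaller modulus. -/
theorem exact_tan_properties (ζ : ℝ) :
    ((if 0 ≤ ζ then 1 else -1) / (|ζ| + √(1 + ζ * ζ))) ^ 2 +
        2 * ζ * ((if 0 ≤ ζ then 1 else -1) / (|ζ| + √(1 + ζ * ζ))) = 1 ∧
      |(if 0 ≤ ζ then 1 else -1) / (|ζ| + √(1 + ζ * ζ))| ≤ 1 := by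
  set r := √(1 + ζ * ζ) with hr
  have hr2 : r ^ 2 = 1 + ζ * ζ := Real.sq_sqrt (by nlinarith)
  have hr1 : 1 ≤ r := Real.one_le_sqrt.mpr (by nlinarith)
  set σ : ℝ := if 0 ≤ ζ then 1 else -1 with hσ
  have h1 : σ ^ 2 = 1 ∧ σ * ζ = |ζ| := by
    rw [hσ]
    split_ifs with h
    · exact ⟨by norm_num, by rw [abs_of_nonneg h, one_mul]⟩
    · exact ⟨by norm_num, by rw [abs_of_neg (not_le.mp h)]; ring⟩
  have h2 : 0 < |ζ| + r := by positivity
  have h3 : |ζ| ^ 2 = ζ * ζ := by rw [sq_abs, sq]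
  constructor
  · field_simp
    nlinarith [h1.1, h1.2]
  · have h4 : |σ| = 1 := by
      rw [← sq_abs] at h1
      nlinarith [h1.1, abs_nonneg σ]
    rw [abs_div, h4, abs_of_pos h2, div_le_one h2]
    linarith [abs_nonneg ζ]

/-- The computed tangent for the pivot block `[[a, c], [c, b]]`: it annihilates the pivot up to a
relative error, and it is small if the block is strongly graded. -/
theorem jacobiTan_properties {u : ℝ} {fl : ℝ → ℝ} (hu : 0 ≤ u) (hu1 : u ≤ 1 / 1000)
    (hfl : IsRounding u fl) (a b : ℝ) {c : ℝ} (hc : c ≠ 0) :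
    |jacobiTan fl a b c| ≤ 2 ∧ |jacobiTan fl a b c| * |b - a| ≤ 3 * |c| ∧
      |(a - b) * jacobiTan fl a b c + c * (1 - jacobiTan fl a b c ^ 2)| ≤ 50 * u * |c| := by
  have hu2 : u < 1 := by linarith
  set ζ := (b - a) / (2 * c) with hζ
  have h1 : RelClose u 3 (jacobiZeta fl a b c) ζ :=
    (((RelClose.of_rounding hfl hu hu2 (b - a)).div hu2
      (RelClose.of_rounding hfl hu hu2 (2 * c))).fl hfl hu hu2)
  have hsq : RelClose u 9 (fl √(fl (1 + fl (jacobiZeta fl a b c * jacobiZeta fl a b c))))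
      √(1 + ζ * ζ) := by
    have h2 := (h1.mul hu2 h1).fl hfl hu hu2
    have h3 := ((RelClose.refl u 1).mono hu hu2 (Nat.zero_le _)).add zero_le_one
      (mul_self_nonneg ζ) h2
    exact ((h3.fl hfl hu hu2).sqrt hu hu2).fl hfl hu hu2
  set t := (if 0 ≤ ζ then 1 else -1) / (|ζ| + √(1 + ζ * ζ)) with ht
  -- all sums are sums of nonnegative terms, so nothing cancels after the first subtraction
  have h4 : RelClose u 11 (jacobiTan fl a b c) t := by
    have h5 := ((((h1.abs hu2).mono hu hu2 (by norm_num : 3 ≤ 9)).add (abs_nonneg _)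
      (Real.sqrt_nonneg _) hsq).fl hfl hu hu2)
    have h6 : (if 0 ≤ jacobiZeta fl a b c then (1 : ℝ) else -1) = if 0 ≤ ζ then 1 else -1 :=
      if_congr (h1.nonneg_iff hu2) rfl rfl
    rw [jacobiTan, h6]
    have h7 := ((RelClose.refl u (if 0 ≤ ζ then 1 else -1)).div hu2 h5).fl hfl hu hu2
    exact h7.mono hu hu2 (by norm_num)
  obtain ⟨h5, h6⟩ := exact_tan_properties ζ
  rw [← ht] at h5 h6
  obtain ⟨ρ, hρ, h7⟩ := h4.exists_abs_sub_le hu hu2 (by norm_num; linarith)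
  norm_num at hρ
  have hρ1 := abs_le.mp hρ
  have ht2 : t ^ 2 ≤ 1 := by rw [← sq_abs]; nlinarith [abs_nonneg t]
  have hba : b - a = 2 * ζ * c := by rw [hζ]; field_simp
  have hρa : |ρ| ≤ 11 / 10 := abs_le.mpr ⟨by linarith, by linarith⟩
  refine ⟨?_, ?_, ?_⟩
  · rw [h7, abs_mul]
    nlinarith [abs_nonneg ρ, abs_nonneg t]
  · rw [← abs_mul, hba, h7]
    have h8 : ρ * t * (2 * ζ * c) = ρ * (1 - t ^ 2) * c := by
      rw [← h5]; ring
    rw [h8, abs_mul, abs_mul]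
    refine mul_le_mul_of_nonneg_right ?_ (abs_nonneg _)
    have h9 : |1 - t ^ 2| ≤ 1 := abs_le.mpr ⟨by linarith, by linarith [sq_nonneg t]⟩
    nlinarith [abs_nonneg ρ, abs_nonneg (1 - t ^ 2)]
  · have h8 : (a - b) * jacobiTan fl a b c + c * (1 - jacobiTan fl a b c ^ 2) =
        (1 - ρ) * (1 + ρ * t ^ 2) * c := by
      have : a - b = -(2 * ζ * c) := by linarith
      rw [this, h7]
      linear_combination (ρ * c) * (-h5)
    rw [h8, abs_mul, abs_mul]
    refine mul_le_mul_of_nonneg_right ?_ (abs_nonneg _)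
    have h9 : |1 + ρ * t ^ 2| ≤ 22 / 10 := by
      refine abs_le.mpr ⟨?_, ?_⟩ <;> nlinarith [sq_nonneg t]
    rw [abs_sub_comm] at hρ
    nlinarith [abs_nonneg (1 - ρ), abs_nonneg (1 + ρ * t ^ 2)]

/-- The computed cosine is accurate relative to the angle of the *computed* tangent. -/
theorem jacobiCos_relClose {u : ℝ} {fl : ℝ → ℝ} (hu : 0 ≤ u) (hu1 : u < 1)
    (hfl : IsRounding u fl) (a b c : ℝ) :
    RelClose u 4 (jacobiCos fl a b c) (1 / √(1 + jacobiTan fl a b c * jacobiTan fl a b c)) := by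
  have h1 := (RelClose.of_rounding hfl hu hu1 (jacobiTan fl a b c * jacobiTan fl a b c))
  have h2 := ((RelClose.refl u 1).mono hu hu1 (Nat.zero_le _)).add zero_le_one
    (mul_self_nonneg _) h1
  have h3 := ((h2.fl hfl hu hu1).sqrt hu hu1).fl hfl hu hu1
  exact ((RelClose.refl u 1).div hu1 h3).fl hfl hu hu1

theorem jacobiSin_relClose {u : ℝ} {fl : ℝ → ℝ} (hu : 0 ≤ u) (hu1 : u < 1)
    (hfl : IsRounding u fl) (a b c : ℝ) :
    RelClose u 5 (jacobiSin fl a b c)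
      (1 / √(1 + jacobiTan fl a b c * jacobiTan fl a b c) * jacobiTan fl a b c) :=
  ((jacobiCos_relClose hu hu1 hfl a b c).mul hu1 (RelClose.refl u _)).fl hfl hu hu1

/-! ### One computed rotation -/

theorem sum_eq_pair_add_sum_compl {n : ℕ} {i j : Fin n} (hij : i ≠ j) (f : Fin n → ℝ) :
    ∑ k, f k = f i + f j + ∑ k ∈ ({i, j} : Finset (Fin n))ᶜ, f k := by
  rw [← Finset.sum_add_sum_compl {i, j} f, Finset.sum_pair hij]

theorem ne_of_mem_compl_pair {n : ℕ} {i j k : Fin n} (hk : k ∈ ({i, j} : Finset (Fin n))ᶜ) :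
    k ≠ i ∧ k ≠ j := by
  simpa using hk

theorem form_eq_pivot_split {n : ℕ} {H : Matrix (Fin n) (Fin n) ℝ} (hH : ∀ k l, H l k = H k l)
    {i j : Fin n} (hij : i ≠ j) (x : Fin n → ℝ) :
    x ⬝ᵥ H *ᵥ x = H i i * x i ^ 2 + 2 * H i j * (x i * x j) + H j j * x j ^ 2 +
      2 * (x i * ∑ k ∈ ({i, j} : Finset (Fin n))ᶜ, H i k * x k) +
      2 * (x j * ∑ k ∈ ({i, j} : Finset (Fin n))ᶜ, H j k * x k) +
      ∑ k ∈ ({i, j} : Finset (Fin n))ᶜ, ∑ l ∈ ({i, j} : Finset (Fin n))ᶜ,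
        x k * (H k l * x l) := by
  simp only [dotProduct, mulVec]
  rw [sum_eq_pair_add_sum_compl hij]
  have h1 : ∀ k, ∑ l, H k l * x l = H k i * x i + H k j * x j +
      ∑ l ∈ ({i, j} : Finset (Fin n))ᶜ, H k l * x l := fun k => sum_eq_pair_add_sum_compl hij _
  have h2 : ∑ k ∈ ({i, j} : Finset (Fin n))ᶜ, x k * ∑ l, H k l * x l =
      x i * ∑ k ∈ ({i, j} : Finset (Fin n))ᶜ, H i k * x k +
      x j * ∑ k ∈ ({i, j} : Finset (Fin n))ᶜ, H j k * x k +
      ∑ k ∈ ({i, j} : Finset (Fin n))ᶜ, ∑ l ∈ ({i, j} : Finset (Fin n))ᶜ,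
        x k * (H k l * x l) := by
    rw [Finset.mul_sum, Finset.mul_sum, ← Finset.sum_add_distrib, ← Finset.sum_add_distrib]
    refine Finset.sum_congr rfl fun k _ => ?_
    rw [h1, ← Finset.mul_sum, hH i k, hH j k]
    ring
  rw [h2, h1, h1, hH i j]
  ring

/-- The plane rotation `x ↦ y` with `y i = c x i + s x j` and `y j = - s x i + c x j`. -/
theorem exists_planeRotation {n : ℕ} {i j : Fin n} (hij : i ≠ j) {c s : ℝ}
    (hcs : c ^ 2 + s ^ 2 = 1) :
    ∃ J : (Fin n → ℝ) ≃ₗ[ℝ] (Fin n → ℝ), (∀ x, J x ⬝ᵥ J x = x ⬝ᵥ x) ∧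
      ∀ x, J x i = c * x i + s * x j ∧ J x j = -s * x i + c * x j ∧
        ∀ k, k ≠ i → k ≠ j → J x k = x k := by
  let L : (Fin n → ℝ) →ₗ[ℝ] (Fin n → ℝ) := LinearMap.pi fun k =>
    if k = i then c • LinearMap.proj i + s • LinearMap.proj j
    else if k = j then (-s) • LinearMap.proj i + c • LinearMap.proj j else LinearMap.proj k
  have h1 : ∀ x, L x i = c * x i + s * x j := fun x => by simp [L]
  have h2 : ∀ x, L x j = -s * x i + c * x j := fun x => by simp [L, hij.symm]
  have h3 : ∀ x k, k ≠ i → k ≠ j → L x k = x k := fun x k hi hj => by simp [L, hi, hj]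
  have hiso : ∀ x, L x ⬝ᵥ L x = x ⬝ᵥ x := fun x => by
    rw [dotProduct_self_eq_sum_sq, dotProduct_self_eq_sum_sq, sum_eq_pair_add_sum_compl hij,
      sum_eq_pair_add_sum_compl hij (fun k => x k ^ 2), h1, h2]
    have h4 : ∑ k ∈ ({i, j} : Finset (Fin n))ᶜ, L x k ^ 2 =
        ∑ k ∈ ({i, j} : Finset (Fin n))ᶜ, x k ^ 2 := by
      refine Finset.sum_congr rfl fun k hk => ?_
      rw [h3 x k (ne_of_mem_compl_pair hk).1 (ne_of_mem_compl_pair hk).2]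
    rw [h4]
    linear_combination (x i ^ 2 + x j ^ 2) * hcs
  have hinj : Function.Injective L := by
    rw [injective_iff_map_eq_zero]
    intro x hx
    by_contra h
    have := hiso x
    simp only [hx, zero_dotProduct] at this
    exact (dotProduct_self_pos h).ne this
  exact ⟨LinearEquiv.ofInjectiveEndo L hinj, hiso, fun x => ⟨h1 x, h2 x, h3 x⟩⟩

theorem RelClose.abs_fl_add_sub_le {u : ℝ} {fl : ℝ → ℝ} (hu : 0 ≤ u) (hu1 : u ≤ 1 / 1000)
    (hfl : IsRounding u fl) {x x' y y' : ℝ} (hx : RelClose u 6 x' x) (hy : RelClose u 6 y' y) :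
    |fl (x' + y') - (x + y)| ≤ 20 * u * (|x| + |y|) := by
  have h1 := hx.abs_sub_le hu (by linarith) (by norm_num; linarith)
  have h2 := hy.abs_sub_le hu (by linarith) (by norm_num; linarith)
  norm_num at h1 h2
  have h3 := hfl (x' + y')
  have h4 := abs_add_le x' y'
  have h5 := abs_sub_abs_le_abs_sub x' x
  have h6 := abs_sub_abs_le_abs_sub y' y
  have h7 : |x' + y'| ≤ 2 * (|x| + |y|) := by
    have := mul_le_mul_of_nonneg_right (by linarith : 12 * u ≤ 1) (abs_nonneg x)
    have := mul_le_mul_of_nonneg_right (by linarith : 12 * u ≤ 1) (abs_nonneg y)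
    linarith
  have h8 : |fl (x' + y') - (x + y)| ≤ |fl (x' + y') - (x' + y')| + (|x' - x| + |y' - y|) :=
    calc _ = |(fl (x' + y') - (x' + y')) + ((x' - x) + (y' - y))| := by congr 1; ring
      _ ≤ _ := (abs_add_le _ _).trans (by linarith [abs_add_le (x' - x) (y' - y)])
  have h9 := mul_le_mul_of_nonneg_left h7 hu
  have h10 : 0 ≤ u * (|x| + |y|) := by positivity
  linarith

theorem RelClose.neg {u : ℝ} {k : ℕ} {x x' : ℝ} (h : RelClose u k x' x) :
    RelClose u k (-x') (-x) := by
  obtain ⟨ρ, h1, h2, h3⟩ := h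
  exact ⟨ρ, h1, h2, by rw [h3]; ring⟩

theorem RelClose.abs_fl_sub_sub_le {u : ℝ} {fl : ℝ → ℝ} (hu : 0 ≤ u) (hu1 : u ≤ 1 / 1000)
    (hfl : IsRounding u fl) {x x' y y' : ℝ} (hx : RelClose u 6 x' x) (hy : RelClose u 6 y' y) :
    |fl (x' - y') - (x - y)| ≤ 20 * u * (|x| + |y|) := by
  have := RelClose.abs_fl_add_sub_le hu hu1 hfl hx hy.neg
  rwa [abs_neg, ← sub_eq_add_neg, ← sub_eq_add_neg] at this

/-- The combination of the entrywise errors of a computed rotation. All errors are measured with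
the diagonal scaling `p`, `q` of the old matrix; `N` is the scaled length of the rotated vector. -/
theorem rotation_error_combine {u m N p q X Y e₁ e₂ e₃ f₁ f₂ s : ℝ} (hu : 0 ≤ u) (hm : 1 ≤ m)
    (hN : 0 ≤ N) (hp : 0 ≤ p) (hq : 0 ≤ q)
    (hX : p * |X| ≤ 5 * N) (hY : q * |Y| ≤ 5 * N) (hsX : |s| * q * |X| ≤ 5 * N)
    (hsY : |s| * p * |Y| ≤ 5 * N) (he₁ : |e₁| ≤ 300 * u * p ^ 2) (he₂ : |e₂| ≤ 300 * u * q ^ 2)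
    (he₃ : |e₃| ≤ 50 * u * (p * q)) (hf₁ : |f₁| ≤ 20 * u * (m * N * (p + |s| * q)))
    (hf₂ : |f₂| ≤ 20 * u * (m * N * (|s| * p + q))) :
    |e₁ * X ^ 2 + 2 * e₃ * (X * Y) + e₂ * Y ^ 2 + 2 * (X * f₁) + 2 * (Y * f₂)| ≤
      20000 * u * (m * N ^ 2) := by
  have h1 : |e₁ * X ^ 2| ≤ 300 * u * 25 * N ^ 2 := by
    rw [abs_mul, abs_pow]
    calc |e₁| * |X| ^ 2 ≤ 300 * u * p ^ 2 * |X| ^ 2 := by gcongr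
      _ = 300 * u * (p * |X|) ^ 2 := by ring
      _ ≤ 300 * u * (5 * N) ^ 2 := by gcongr
      _ = _ := by ring
  have h2 : |e₂ * Y ^ 2| ≤ 300 * u * 25 * N ^ 2 := by
    rw [abs_mul, abs_pow]
    calc |e₂| * |Y| ^ 2 ≤ 300 * u * q ^ 2 * |Y| ^ 2 := by gcongr
      _ = 300 * u * (q * |Y|) ^ 2 := by ring
      _ ≤ 300 * u * (5 * N) ^ 2 := by gcongr
      _ = _ := by ring
  have h3 : |2 * e₃ * (X * Y)| ≤ 2 * 50 * u * 25 * N ^ 2 := by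
    rw [abs_mul, abs_mul, abs_mul, abs_two]
    calc 2 * |e₃| * (|X| * |Y|) ≤ 2 * (50 * u * (p * q)) * (|X| * |Y|) := by gcongr
      _ = 2 * 50 * u * ((p * |X|) * (q * |Y|)) := by ring
      _ ≤ 2 * 50 * u * ((5 * N) * (5 * N)) := by gcongr
      _ = _ := by ring
  have h4 : |2 * (X * f₁)| ≤ 400 * u * (m * N ^ 2) := by
    rw [abs_mul, abs_mul, abs_two]
    calc 2 * (|X| * |f₁|) ≤ 2 * (|X| * (20 * u * (m * N * (p + |s| * q)))) := by gcongr
      _ = 40 * u * (m * N * (p * |X| + |s| * q * |X|)) := by ring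
      _ ≤ 40 * u * (m * N * (5 * N + 5 * N)) := by gcongr
      _ = _ := by ring
  have h5 : |2 * (Y * f₂)| ≤ 400 * u * (m * N ^ 2) := by
    rw [abs_mul, abs_mul, abs_two]
    calc 2 * (|Y| * |f₂|) ≤ 2 * (|Y| * (20 * u * (m * N * (|s| * p + q)))) := by gcongr
      _ = 40 * u * (m * N * (|s| * p * |Y| + q * |Y|)) := by ring
      _ ≤ 40 * u * (m * N * (5 * N + 5 * N)) := by gcongr
      _ = _ := by ring
  have h6 : u * N ^ 2 ≤ u * (m * N ^ 2) := by
    gcongr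
    nlinarith [sq_nonneg N]
  have h7 := abs_add_le (e₁ * X ^ 2 + 2 * e₃ * (X * Y) + e₂ * Y ^ 2 + 2 * (X * f₁)) (2 * (Y * f₂))
  have h8 := abs_add_le (e₁ * X ^ 2 + 2 * e₃ * (X * Y) + e₂ * Y ^ 2) (2 * (X * f₁))
  have h9 := abs_add_le (e₁ * X ^ 2 + 2 * e₃ * (X * Y)) (e₂ * Y ^ 2)
  have h10 := abs_add_le (e₁ * X ^ 2) (2 * e₃ * (X * Y))
  have h11 : 0 ≤ u * (m * N ^ 2) := by positivity
  linarith

/-- A small pivot relative to the gap of the diagonal keeps the tangent below the ratio of the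
scaling factors. -/
theorem abs_tan_mul_le {t p q : ℝ} (hp : 0 < p) (hq : 0 < q) (h2 : |t| ≤ 2)
    (h : |t| * |q ^ 2 - p ^ 2| ≤ 3 * (p * q)) : |t| * q ≤ 4 * p := by
  rcases le_total q (2 * p) with h1 | h1
  · nlinarith [abs_nonneg t]
  · have h3 : 3 / 4 * q ^ 2 ≤ |q ^ 2 - p ^ 2| := le_trans (by nlinarith) (le_abs_self _)
    have h4 := mul_le_mul_of_nonneg_left h3 (abs_nonneg t)
    have h5 : (|t| * q) * q ≤ (4 * p) * q := by linarith
    exact le_of_mul_le_mul_right h5 hq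

theorem jacobiRotate_symm {n : ℕ} (fl : ℝ → ℝ) {H : Matrix (Fin n) (Fin n) ℝ}
    (hH : ∀ k l, H l k = H k l) (i j : Fin n) (k l : Fin n) :
    jacobiRotate fl H i j l k = jacobiRotate fl H i j k l := by
  unfold jacobiRotate
  simp only []
  split_ifs with h0
  · exact hH k l
  simp only [of_apply]
  grind

theorem jacobiRotate_entries {n : ℕ} (fl : ℝ → ℝ) {H : Matrix (Fin n) (Fin n) ℝ} {i j : Fin n}
    (hij : i ≠ j) (h0 : H i j ≠ 0) :
    jacobiRotate fl H i j i i =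
        fl (H i i - fl (H i j * jacobiTan fl (H i i) (H j j) (H i j))) ∧
      jacobiRotate fl H i j j j =
        fl (H j j + fl (H i j * jacobiTan fl (H i i) (H j j) (H i j))) ∧
      jacobiRotate fl H i j i j = 0 ∧
      (∀ k, k ≠ i → k ≠ j → jacobiRotate fl H i j i k =
        fl (fl (jacobiCos fl (H i i) (H j j) (H i j) * H i k) -
          fl (jacobiSin fl (H i i) (H j j) (H i j) * H j k))) ∧
      (∀ k, k ≠ i → k ≠ j → jacobiRotate fl H i j j k =
        fl (fl (jacobiSin fl (H i i) (H j j) (H i j) * H i k) +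
          fl (jacobiCos fl (H i i) (H j j) (H i j) * H j k))) ∧
      ∀ k l, k ≠ i → k ≠ j → l ≠ i → l ≠ j → jacobiRotate fl H i j k l = H k l := by
  unfold jacobiRotate
  simp only [if_neg h0, of_apply]
  refine ⟨by simp, by simp [hij.symm], by simp [hij, hij.symm], fun k hk hk' => ?_,
    fun k hk hk' => ?_, fun k l hk hk' hl hl' => ?_⟩
  · simp [hk, hk', hij]
  · simp [hk, hk', hij.symm]
  · simp [hk, hk', hl, hl']

/-- Off-diagonal part of a row of the rotated matrix, applied to a vector that agrees on `K` with
`y`: `r` is the computed combination of the rows `p` and `q`. -/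
theorem abs_sum_rotated_sub_le {n : ℕ} {K : Finset (Fin n)} {r p q x y : Fin n → ℝ}
    {c s ε N P Q : ℝ}
    (hε : 0 ≤ ε) (hxy : ∀ k ∈ K, y k = x k)
    (hr : ∀ k ∈ K, |r k - (c * p k + s * q k)| ≤ ε * (|c * p k| + |s * q k|))
    (hp : ∑ k, |p k| * |y k| ≤ N * P) (hq : ∑ k, |q k| * |y k| ≤ N * Q) :
    |c * ∑ k ∈ K, p k * x k + s * ∑ k ∈ K, q k * x k - ∑ k ∈ K, r k * x k| ≤
      ε * (N * (|c| * P + |s| * Q)) := by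
  have h1 : ∀ f : Fin n → ℝ, ∑ k ∈ K, |f k| * |x k| ≤ ∑ k, |f k| * |y k| := fun f => by
    calc ∑ k ∈ K, |f k| * |x k| = ∑ k ∈ K, |f k| * |y k| :=
          Finset.sum_congr rfl fun k hk => by rw [hxy k hk]
      _ ≤ _ := Finset.sum_le_sum_of_subset_of_nonneg (Finset.subset_univ _)
          fun k _ _ => by positivity
  rw [Finset.mul_sum, Finset.mul_sum, ← Finset.sum_add_distrib, ← Finset.sum_sub_distrib]
  calc |∑ k ∈ K, (c * (p k * x k) + s * (q k * x k) - r k * x k)|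
      ≤ ∑ k ∈ K, ε * (|c| * (|p k| * |x k|) + |s| * (|q k| * |x k|)) := by
        refine (Finset.abs_sum_le_sum_abs _ _).trans (Finset.sum_le_sum fun k hk => ?_)
        have h2 : c * (p k * x k) + s * (q k * x k) - r k * x k =
            -(r k - (c * p k + s * q k)) * x k := by ring
        rw [h2, abs_mul, abs_neg]
        refine (mul_le_mul_of_nonneg_right (hr k hk) (abs_nonneg _)).trans (le_of_eq ?_)
        rw [abs_mul, abs_mul]
        ring
    _ = ε * (|c| * ∑ k ∈ K, |p k| * |x k| + |s| * ∑ k ∈ K, |q k| * |x k|) := by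
        rw [← Finset.mul_sum, Finset.sum_add_distrib, Finset.mul_sum, Finset.mul_sum]
    _ ≤ ε * (|c| * (N * P) + |s| * (N * Q)) := by
        gcongr
        · exact (h1 p).trans hp
        · exact (h1 q).trans hq
    _ = _ := by ring

/-- A rotated coordinate `X` of a vector with coordinates `y`, `z`, measured with either scaling
factor, is bounded by the scaled length `N`. -/
theorem abs_mul_rotated_le {X y z s p q N : ℝ} (hp : 0 ≤ p) (hq : 0 ≤ q) (hs : |s| ≤ 1)
    (hX : |X| ≤ |y| + |s| * |z|) (hy : p * |y| ≤ N) (hz : q * |z| ≤ N) (hsq : |s| * q ≤ 4 * p)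
    (hsp : |s| * p ≤ 4 * q) : p * |X| ≤ 5 * N ∧ |s| * q * |X| ≤ 5 * N := by
  have h0 : 0 ≤ q * |z| := by positivity
  constructor
  · calc p * |X| ≤ p * (|y| + |s| * |z|) := by gcongr
      _ = p * |y| + |s| * p * |z| := by ring
      _ ≤ p * |y| + 4 * q * |z| := by gcongr
      _ ≤ 5 * N := by linarith
  · calc |s| * q * |X| ≤ |s| * q * (|y| + |s| * |z|) := by gcongr
      _ = |s| * q * |y| + |s| * |s| * (q * |z|) := by ring
      _ ≤ 4 * p * |y| + 1 * 1 * (q * |z|) := by gcongr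
      _ ≤ 5 * N := by linarith

/-- Errors of the entries of a computed rotated pivot block. In exact arithmetic the formulas
`h_ii - h_ij t` and `h_jj + h_ij t` rely on `t` annihilating the pivot; the residual of that
equation therefore enters all three entries. -/
theorem pivot_block_error {u : ℝ} {fl : ℝ → ℝ} (hu : 0 ≤ u) (hu1 : u ≤ 1 / 1000)
    (hfl : IsRounding u fl) {a b g t c s p q : ℝ} (hp : 0 ≤ p) (hq : 0 ≤ q) (ha : a = p ^ 2)
    (hb : b = q ^ 2) (hc : c ^ 2 ≤ 1) (hs : s = c * t) (hct : c ^ 2 * (1 + t ^ 2) = 1)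
    (hg : |g| ≤ p * q) (htq : |t| * q ≤ 4 * p) (htp : |t| * p ≤ 4 * q)
    (hres : |(a - b) * t + g * (1 - t ^ 2)| ≤ 50 * u * |g|) :
    |c ^ 2 * a - 2 * c * s * g + s ^ 2 * b - fl (a - fl (g * t))| ≤ 300 * u * p ^ 2 ∧
      |s ^ 2 * a + 2 * c * s * g + c ^ 2 * b - fl (b + fl (g * t))| ≤ 300 * u * q ^ 2 ∧
      |c ^ 2 * ((a - b) * t + g * (1 - t ^ 2))| ≤ 50 * u * (p * q) := by
  have hu2 : u < 1 := by linarith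
  have hgt : RelClose u 6 (fl (g * t)) (g * t) :=
    (RelClose.of_rounding hfl hu hu2 _).mono hu hu2 (by norm_num)
  have hr0 : ∀ z : ℝ, RelClose u 6 z z := fun z =>
    (RelClose.refl u z).mono hu hu2 (by norm_num)
  have hdi := RelClose.abs_fl_sub_sub_le hu hu1 hfl (hr0 a) hgt
  have hdj := RelClose.abs_fl_add_sub_le hu hu1 hfl (hr0 b) hgt
  set res := (a - b) * t + g * (1 - t ^ 2) with hres'
  have hgtp : |g * t| ≤ 4 * p ^ 2 := by
    rw [abs_mul]
    have h1 := mul_le_mul_of_nonneg_right hg (abs_nonneg t)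
    have h2 := mul_le_mul_of_nonneg_left htq hp
    linarith
  have hgtq : |g * t| ≤ 4 * q ^ 2 := by
    rw [abs_mul]
    have h1 := mul_le_mul_of_nonneg_right hg (abs_nonneg t)
    have h2 := mul_le_mul_of_nonneg_left htp hq
    linarith
  have hcorr : |c ^ 2 * t * res| ≤ 50 * u * |g * t| := by
    rw [abs_mul, abs_mul, abs_of_nonneg (sq_nonneg c), abs_mul]
    calc c ^ 2 * |t| * |res| ≤ 1 * |t| * (50 * u * |g|) := by gcongr
      _ = _ := by ring
  refine ⟨?_, ?_, ?_⟩
  · have h1 : c ^ 2 * a - 2 * c * s * g + s ^ 2 * b - fl (a - fl (g * t)) =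
        -(c ^ 2 * t * res) - (fl (a - fl (g * t)) - (a - g * t)) := by
      rw [hs, hres']
      linear_combination (a - g * t) * hct
    rw [h1]
    refine (abs_sub _ _).trans ?_
    rw [abs_neg]
    rw [abs_of_nonneg (by rw [ha]; positivity : 0 ≤ a)] at hdi
    have h2 := mul_le_mul_of_nonneg_left hgtp hu
    have h3 : u * a = u * p ^ 2 := by rw [ha]
    linarith
  · have h1 : s ^ 2 * a + 2 * c * s * g + c ^ 2 * b - fl (b + fl (g * t)) =
        c ^ 2 * t * res - (fl (b + fl (g * t)) - (b + g * t)) := by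
      rw [hs, hres']
      linear_combination (b + g * t) * hct
    rw [h1]
    refine (abs_sub _ _).trans ?_
    rw [abs_of_nonneg (by rw [hb]; positivity : 0 ≤ b)] at hdj
    have h2 := mul_le_mul_of_nonneg_left hgtq hu
    have h3 : u * b = u * q ^ 2 := by rw [hb]
    linarith
  · rw [abs_mul, abs_of_nonneg (sq_nonneg c)]
    calc c ^ 2 * |res| ≤ 1 * (50 * u * |g|) := by gcongr
      _ ≤ 1 * (50 * u * (p * q)) := by gcongr
      _ = _ := one_mul _

/-- One computed rotation changes the quadratic form, up to an exact orthogonal congruence, by a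
relative error `O(u κ₂ˢ(H))` whose constant does not depend on the dimension. The orthogonal factor
is the exact rotation with the *computed* tangent. -/
theorem jacobiRotate_form_error {n : ℕ} {u : ℝ} {fl : ℝ → ℝ} (hu : 0 ≤ u) (hu1 : u ≤ 1 / 1000)
    (hfl : IsRounding u fl) {H : Matrix (Fin n) (Fin n) ℝ} (hH : H.PosDef) {i j : Fin n}
    (hij : i ≠ j) :
    ∃ J : (Fin n → ℝ) ≃ₗ[ℝ] (Fin n → ℝ), (∀ x, J x ⬝ᵥ J x = x ⬝ᵥ x) ∧
      ∀ x, |x ⬝ᵥ jacobiRotate fl H i j *ᵥ x - J x ⬝ᵥ H *ᵥ J x| ≤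
        20000 * u * scaledCond2 H * (J x ⬝ᵥ H *ᵥ J x) := by
  have hn : 0 < n := i.pos
  have hκ := one_le_scaledCond2 hn hH
  rcases eq_or_ne (H i j) 0 with h0 | h0
  · refine ⟨LinearEquiv.refl ℝ _, fun x => rfl, fun x => ?_⟩
    have h1 : jacobiRotate fl H i j = H := by simp [jacobiRotate, h0]
    have h2 := dotProduct_mulVec_nonneg hH x
    simp only [h1, LinearEquiv.refl_apply, sub_self, abs_zero]
    positivity
  obtain ⟨lo, hi, hb, hsc⟩ := exists_scaledBounds hn hH
  have hu2 : u < 1 := by linarith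
  have hsym : ∀ k l, H l k = H k l := fun k l => symm_apply_of_posDef hH k l
  obtain ⟨hE1, hE2, hE3, hE4, hE5, hE6⟩ := jacobiRotate_entries fl hij h0
  have hsym' := jacobiRotate_symm fl hsym i j
  set H' := jacobiRotate fl H i j with hH'
  obtain ⟨ht2, htg, hres⟩ := jacobiTan_properties hu hu1 hfl (H i i) (H j j) h0
  have hcos := jacobiCos_relClose hu hu2 hfl (H i i) (H j j) (H i j)
  have hsin := jacobiSin_relClose hu hu2 hfl (H i i) (H j j) (H i j)
  set t := jacobiTan fl (H i i) (H j j) (H i j) with ht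
  set c := 1 / √(1 + t * t) with hc
  set s := c * t with hs
  have hsqrt : √(1 + t * t) ^ 2 = 1 + t * t := Real.sq_sqrt (by nlinarith)
  have hsqrt1 : 1 ≤ √(1 + t * t) := Real.one_le_sqrt.mpr (by nlinarith)
  have hc0 : 0 < c := by positivity
  have hc1 : c ≤ 1 := by rw [hc, div_le_one (by positivity)]; exact hsqrt1
  have hct : c ^ 2 * (1 + t ^ 2) = 1 := by
    rw [hc, div_pow, hsqrt]
    field_simp
  have hcs : c ^ 2 + s ^ 2 = 1 := by rw [hs, ← hct]; ring
  have hst : |s| ≤ |t| := by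
    rw [hs, abs_mul, abs_of_pos hc0]
    exact mul_le_of_le_one_left (abs_nonneg _) hc1
  have hs1 : |s| ≤ 1 := by
    rw [← sq_le_one_iff_abs_le_one, ← hcs]
    exact le_add_of_nonneg_left (sq_nonneg c)
  obtain ⟨J, hJ, hJx⟩ := exists_planeRotation hij hcs
  refine ⟨J, hJ, fun x => ?_⟩
  obtain ⟨hyi, hyj, hyk⟩ := hJx x
  set y := J x with hy
  set K : Finset (Fin n) := ({i, j} : Finset (Fin n))ᶜ with hK
  set p := √(H i i) with hp
  set q := √(H j j) with hq
  have hp0 : 0 < p := Real.sqrt_pos.mpr (diag_pos_of_posDef hH i)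
  have hq0 : 0 < q := Real.sqrt_pos.mpr (diag_pos_of_posDef hH j)
  have hp2 : H i i = p ^ 2 := (Real.sq_sqrt (diag_pos_of_posDef hH i).le).symm
  have hq2 : H j j = q ^ 2 := (Real.sq_sqrt (diag_pos_of_posDef hH j).le).symm
  have hg : |H i j| ≤ p * q := abs_apply_le_sqrt hH i j
  have htgap : |t| * |q ^ 2 - p ^ 2| ≤ 3 * (p * q) := by
    rw [← hp2, ← hq2]
    linarith
  have htq : |t| * q ≤ 4 * p := abs_tan_mul_le hp0 hq0 ht2 htgap
  have htp : |t| * p ≤ 4 * q := abs_tan_mul_le hq0 hp0 ht2 (by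
    rwa [abs_sub_comm, mul_comm q p])
  -- the scaled length `N` of `y`
  have hd0 : ∀ k, 0 ≤ H k k * y k ^ 2 := fun k =>
    mul_nonneg (diag_pos_of_posDef hH k).le (sq_nonneg _)
  set N := √(∑ k, H k k * y k ^ 2) with hN
  have hN0 : 0 ≤ N := Real.sqrt_nonneg _
  have hN2 : N ^ 2 = ∑ k, H k k * y k ^ 2 := Real.sq_sqrt (Finset.sum_nonneg fun k _ => hd0 k)
  have hyN : ∀ k, √(H k k) * |y k| ≤ N := fun k => by
    rw [hN]
    refine Real.le_sqrt_of_sq_le ?_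
    rw [mul_pow, sq_abs, Real.sq_sqrt (diag_pos_of_posDef hH k).le]
    exact Finset.single_le_sum (f := fun k => H k k * y k ^ 2) (fun k _ => hd0 k)
      (Finset.mem_univ k)
  have hpy : p * |y i| ≤ N := hyN i
  have hqy : q * |y j| ≤ N := hyN j
  set m := √hi with hm
  have hm1 : 1 ≤ m := Real.one_le_sqrt.mpr hb.le_hi
  have hm2 : m ^ 2 = hi := Real.sq_sqrt (by linarith [hb.le_hi])
  have hrow : ∀ l, ∑ k, |H l k| * |y k| ≤ m * N * √(H l l) := fun l => by
    refine le_of_sq_le_sq ?_ (by positivity)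
    refine (hb.sum_abs_row_sq_le hH l y).trans (le_of_eq ?_)
    rw [mul_pow, mul_pow, hm2, hN2, Real.sq_sqrt (diag_pos_of_posDef hH l).le]
    ring
  -- the old coordinates in terms of the rotated ones
  have hxi : x i = c * y i - s * y j := by
    rw [hyi, hyj]
    linear_combination (-x i) * hcs
  have hxj : x j = s * y i + c * y j := by
    rw [hyi, hyj]
    linear_combination (-x j) * hcs
  have hxi' : |x i| ≤ |y i| + |s| * |y j| := by
    rw [hxi]
    refine (abs_sub _ _).trans ?_
    rw [abs_mul, abs_mul, abs_of_pos hc0]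
    gcongr
    exact mul_le_of_le_one_left (abs_nonneg _) hc1
  have hxj' : |x j| ≤ |y j| + |s| * |y i| := by
    rw [hxj, add_comm]
    refine (abs_add_le _ _).trans ?_
    rw [abs_mul, abs_mul, abs_of_pos hc0]
    gcongr
    exact mul_le_of_le_one_left (abs_nonneg _) hc1
  have hsq : |s| * q ≤ 4 * p := (mul_le_mul_of_nonneg_right hst hq0.le).trans htq
  have hsp : |s| * p ≤ 4 * q := (mul_le_mul_of_nonneg_right hst hp0.le).trans htp
  obtain ⟨hX, hsX⟩ := abs_mul_rotated_le hp0.le hq0.le hs1 hxi' hpy hqy hsq hsp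
  obtain ⟨hY, hsY⟩ := abs_mul_rotated_le hq0.le hp0.le hs1 hxj' hqy hpy hsp hsq
  have hc2 : c ^ 2 ≤ 1 := pow_le_one₀ hc0.le hc1
  obtain ⟨he₁, he₂, he₃⟩ := pivot_block_error hu hu1 hfl hp0.le hq0.le hp2 hq2 hc2 hs hct hg
    htq htp hres
  rw [← hE1] at he₁
  rw [← hE2] at he₂
  set res := (H i i - H j j) * t + H i j * (1 - t ^ 2) with hres'
  -- errors of the two rows
  have hyK : ∀ k ∈ K, y k = x k := fun k hk =>
    hyk k (ne_of_mem_compl_pair hk).1 (ne_of_mem_compl_pair hk).2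
  have hcosm : ∀ z : ℝ, RelClose u 6 (fl (jacobiCos fl (H i i) (H j j) (H i j) * z)) (c * z) :=
    fun z => ((hcos.mul hu2 (RelClose.refl u z)).fl hfl hu hu2).mono hu hu2 (by norm_num)
  have hsinm : ∀ z : ℝ, RelClose u 6 (fl (jacobiSin fl (H i i) (H j j) (H i j) * z)) (s * z) :=
    fun z => ((hsin.mul hu2 (RelClose.refl u z)).fl hfl hu hu2).mono hu hu2 (by norm_num)
  have hf₁ : |c * ∑ k ∈ K, H i k * x k + (-s) * ∑ k ∈ K, H j k * x k - ∑ k ∈ K, H' i k * x k| ≤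
      20 * u * (m * N * (p + |s| * q)) := by
    refine (abs_sum_rotated_sub_le (y := y) (ε := 20 * u) (by positivity) hyK (fun k hk => ?_)
      (hrow i) (hrow j)).trans ?_
    · have h1 := RelClose.abs_fl_sub_sub_le hu hu1 hfl (hcosm (H i k)) (hsinm (H j k))
      rw [← hE4 k (ne_of_mem_compl_pair hk).1 (ne_of_mem_compl_pair hk).2] at h1
      rwa [neg_mul, abs_neg, ← sub_eq_add_neg]
    · rw [abs_neg, abs_of_pos hc0]
      gcongr
      exact mul_le_of_le_one_left hp0.le hc1
  have hf₂ : |s * ∑ k ∈ K, H i k * x k + c * ∑ k ∈ K, H j k * x k - ∑ k ∈ K, H' j k * x k| ≤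
      20 * u * (m * N * (|s| * p + q)) := by
    refine (abs_sum_rotated_sub_le (y := y) (ε := 20 * u) (by positivity) hyK (fun k hk => ?_)
      (hrow i) (hrow j)).trans ?_
    · have h1 := RelClose.abs_fl_add_sub_le hu hu1 hfl (hsinm (H i k)) (hcosm (H j k))
      rwa [← hE5 k (ne_of_mem_compl_pair hk).1 (ne_of_mem_compl_pair hk).2] at h1
    · rw [abs_of_pos hc0]
      gcongr
      exact mul_le_of_le_one_left hq0.le hc1
  have hcomb := rotation_error_combine hu hm1 hN0 hp0.le hq0.le hX hY hsX hsY he₁ he₂ he₃ hf₁ hf₂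
  -- the sum of these errors is the change of the form
  have hsplit : x ⬝ᵥ H' *ᵥ x - y ⬝ᵥ H *ᵥ y =
      -((c ^ 2 * H i i - 2 * c * s * H i j + s ^ 2 * H j j - H' i i) * x i ^ 2 +
        2 * (c ^ 2 * res) * (x i * x j) +
        (s ^ 2 * H i i + 2 * c * s * H i j + c ^ 2 * H j j - H' j j) * x j ^ 2 +
        2 * (x i * (c * ∑ k ∈ K, H i k * x k + (-s) * ∑ k ∈ K, H j k * x k -
          ∑ k ∈ K, H' i k * x k)) +
        2 * (x j * (s * ∑ k ∈ K, H i k * x k + c * ∑ k ∈ K, H j k * x k -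
          ∑ k ∈ K, H' j k * x k))) := by
    rw [form_eq_pivot_split hsym' hij x, form_eq_pivot_split hsym hij y, hE3]
    have h1 : ∀ l, ∑ k ∈ K, H l k * y k = ∑ k ∈ K, H l k * x k := fun l =>
      Finset.sum_congr rfl fun k hk => by rw [hyK k hk]
    have h2 : ∑ k ∈ K, ∑ l ∈ K, y k * (H k l * y l) =
        ∑ k ∈ K, ∑ l ∈ K, x k * (H' k l * x l) :=
      Finset.sum_congr rfl fun k hk => Finset.sum_congr rfl fun l hl => by
        rw [hyK k hk, hyK l hl, hE6 k l (ne_of_mem_compl_pair hk).1 (ne_of_mem_compl_pair hk).2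
          (ne_of_mem_compl_pair hl).1 (ne_of_mem_compl_pair hl).2]
    rw [← hK, h1, h1, h2, hyi, hyj, hres', hs]
    ring
  rw [hsplit, abs_neg]
  refine hcomb.trans ?_
  have h1 : m ≤ hi := by rw [← hm2]; exact le_self_pow₀ hm1 two_ne_zero
  have hhi0 : 0 ≤ hi := zero_le_one.trans hb.le_hi
  have h2 : N ^ 2 ≤ (y ⬝ᵥ H *ᵥ y) / lo := by
    rw [le_div_iff₀ hb.lo_pos, hN2, mul_comm]
    exact hb.le_form y
  calc 20000 * u * (m * N ^ 2) ≤ 20000 * u * (hi * ((y ⬝ᵥ H *ᵥ y) / lo)) := by gcongr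
    _ = 20000 * u * scaledCond2 H * (y ⬝ᵥ H *ᵥ y) := by
      rw [hsc]
      ring

/-! ### Eigenvalues along the computation -/

theorem abs_dotProduct_mulVec_sub_le_of_specNorm {n : ℕ} {Q : Matrix (Fin n) (Fin n) ℝ} {p : ℝ}
    (h : specNorm (Qᵀ * Q - 1) ≤ p) (x : Fin n → ℝ) :
    |(Q *ᵥ x) ⬝ᵥ (Q *ᵥ x) - x ⬝ᵥ x| ≤ p * (x ⬝ᵥ x) := by
  have h1 : (Q *ᵥ x) ⬝ᵥ (Q *ᵥ x) - x ⬝ᵥ x = x ⬝ᵥ (Qᵀ * Q - 1) *ᵥ x := by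
    have h2 := dotProduct_conj 1 Q x
    rw [mul_one, one_mulVec] at h2
    rw [sub_mulVec, dotProduct_sub, h2, one_mulVec]
  set v : EuclideanSpace ℝ (Fin n) := WithLp.toLp 2 x with hv
  have h3 : x ⬝ᵥ (Qᵀ * Q - 1) *ᵥ x = inner ℝ v (toEuclideanCLM (𝕜 := ℝ) (Qᵀ * Q - 1) v) :=
    (inner_toEuclideanCLM (Qᵀ * Q - 1) v v).symm
  have h4 : ‖v‖ * ‖v‖ = x ⬝ᵥ x := by
    rw [← sq, EuclideanSpace.real_norm_sq_eq, dotProduct_self_eq_sum_sq]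
  rw [h1, h3]
  calc |inner ℝ v (toEuclideanCLM (𝕜 := ℝ) (Qᵀ * Q - 1) v)|
      ≤ ‖v‖ * ‖toEuclideanCLM (𝕜 := ℝ) (Qᵀ * Q - 1) v‖ := abs_real_inner_le_norm _ _
    _ ≤ ‖v‖ * (specNorm (Qᵀ * Q - 1) * ‖v‖) := by
        gcongr
        exact ContinuousLinearMap.le_opNorm _ _
    _ ≤ ‖v‖ * (p * ‖v‖) := by gcongr
    _ = p * (x ⬝ᵥ x) := by rw [← h4]; ring

/-- Ostrowski's theorem for the nearly orthogonal congruence `Qᵀ A Q`. -/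
theorem eigDesc_congr_bounds {n : ℕ} {A Q : Matrix (Fin n) (Fin n) ℝ} {p : ℝ} (hA : A.PosDef)
    (h : specNorm (Qᵀ * Q - 1) ≤ p) (hp : p < 1) :
    (Qᵀ * A * Q).PosDef ∧ ∀ k, eigDesc (Qᵀ * A * Q) k ≤ (1 + p) * eigDesc A k ∧
      (1 - p) * eigDesc A k ≤ eigDesc (Qᵀ * A * Q) k := by
  have hQ := abs_dotProduct_mulVec_sub_le_of_specNorm h
  have hinj : Function.Injective Q.mulVecLin := by
    rw [injective_iff_map_eq_zero]
    intro x hx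
    by_contra h0
    have h1 := (abs_le.mp (hQ x)).1
    have h2 := dotProduct_self_pos h0
    rw [mulVecLin_apply] at hx
    rw [hx, zero_dotProduct] at h1
    nlinarith
  have hherm : (Qᵀ * A * Q).IsHermitian := by
    simpa using isHermitian_conjTranspose_mul_mul Q hA.isHermitian
  have hpos : (Qᵀ * A * Q).PosDef := posDef_of_forall_pos hherm fun x hx => by
    rw [dotProduct_conj]
    refine dotProduct_mulVec_pos hA fun h0 => hx ?_
    exact hinj (by simpa using h0)
  refine ⟨hpos, fun k => ?_⟩
  have h1 := (isSortedSpectrum_eigDesc hA.isHermitian).relative_perturbation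
    (isSortedSpectrum_eigDesc hherm) hA (LinearEquiv.ofInjectiveEndo Q.mulVecLin hinj)
    (η := 0) (p := p) le_rfl one_pos hp
    (fun x => by simp [LinearEquiv.coe_ofInjectiveEndo, dotProduct_conj]) (fun x => hQ x) k
  simpa using h1

/-- A relative perturbation of the quadratic form perturbs all eigenvalues by the same relative
amount, also through an orthogonal congruence. -/
theorem eigDesc_relative_perturbation {n : ℕ} {A B : Matrix (Fin n) (Fin n) ℝ} {η : ℝ}
    (hA : A.PosDef) (hB : B.IsHermitian) (J : (Fin n → ℝ) ≃ₗ[ℝ] (Fin n → ℝ))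
    (hJ : ∀ x, J x ⬝ᵥ J x = x ⬝ᵥ x) (hη0 : 0 ≤ η) (hη : η < 1)
    (h : ∀ x, |x ⬝ᵥ B *ᵥ x - J x ⬝ᵥ A *ᵥ J x| ≤ η * (J x ⬝ᵥ A *ᵥ J x)) :
    B.PosDef ∧ ∀ k, eigDesc B k ≤ (1 + η) * eigDesc A k ∧
      (1 - η) * eigDesc A k ≤ eigDesc B k := by
  refine ⟨posDef_of_forall_pos hB fun x hx => ?_, fun k => ?_⟩
  · have h1 : 0 < J x ⬝ᵥ A *ᵥ J x := dotProduct_mulVec_pos hA (by simpa using hx)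
    have h2 := (abs_le.mp (h x)).1
    nlinarith
  · have h1 := (isSortedSpectrum_eigDesc hA.isHermitian).relative_perturbation
      (isSortedSpectrum_eigDesc hB) hA J hη0 hη one_pos h (fun x => by simp [hJ]) k
    simpa using h1

theorem eigDesc_pos {n : ℕ} {A : Matrix (Fin n) (Fin n) ℝ} (hA : A.PosDef) (k : Fin n) :
    0 < eigDesc A k :=
  (isSortedSpectrum_eigDesc hA.isHermitian).pos (fun _ hx => dotProduct_mulVec_pos hA hx) k

/-- An entrywise perturbation of size `ε √(a_ii a_jj)` perturbs the eigenvalues relatively by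
`ε n κ₂ˢ(A)`. -/
theorem eigDesc_scaled_perturbation {n : ℕ} (hn : 0 < n) {A B : Matrix (Fin n) (Fin n) ℝ} {ε : ℝ}
    (hA : A.PosDef) (hB : B.IsHermitian) (hε : 0 ≤ ε) (hε1 : ε * n * scaledCond2 A < 1)
    (h : ∀ i j, |B i j - A i j| ≤ ε * (√(A i i) * √(A j j))) :
    B.PosDef ∧ ∀ k, eigDesc B k ≤ (1 + ε * n * scaledCond2 A) * eigDesc A k ∧
      (1 - ε * n * scaledCond2 A) * eigDesc A k ≤ eigDesc B k := by
  have hκ := one_le_scaledCond2 hn hA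
  refine eigDesc_relative_perturbation hA hB (LinearEquiv.refl ℝ _) (fun x => rfl)
    (by positivity) hε1 fun x => ?_
  rw [LinearEquiv.refl_apply, ← dotProduct_sub, ← sub_mulVec, mul_assoc (ε * n)]
  exact (abs_form_le_of_abs_apply_le (fun i => (diag_pos_of_posDef hA i).le) hε h x).trans
    (mul_le_mul_of_nonneg_left (sum_diag_mul_sq_le hn hA x) (by positivity))

/-- Eigenvalue bounds along a run in which every rotation has relative error at most `η`. The second
bound is stated with the factor on the new eigenvalue so that both sides use `(1 - η) ^ m`. -/
theorem jacobiIterate_eig_bounds {n : ℕ} {u η : ℝ} {fl : ℝ → ℝ} (hu : 0 ≤ u) (hu1 : u ≤ 1 / 1000)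
    (hfl : IsRounding u fl) {H : Matrix (Fin n) (Fin n) ℝ} (hH : H.PosDef)
    {piv : ℕ → Fin n × Fin n} {M : ℕ} (hpiv : ∀ m < M, (piv m).1 < (piv m).2) (hη0 : 0 ≤ η)
    (hη1 : η < 1) (hη : ∀ m < M, 20000 * u * scaledCond2 (jacobiIterate fl piv H m) ≤ η) :
    ∀ m ≤ M, (jacobiIterate fl piv H m).PosDef ∧ ∀ k,
      (1 - η) ^ m * eigDesc H k ≤ eigDesc (jacobiIterate fl piv H m) k ∧
        (1 - η) ^ m * eigDesc (jacobiIterate fl piv H m) k ≤ eigDesc H k := by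
  intro m
  induction m with
  | zero => exact fun _ => ⟨hH, fun k => by simp [jacobiIterate]⟩
  | succ m ih =>
    intro hm
    obtain ⟨hP, hE⟩ := ih (by omega)
    have hij := (hpiv m (by omega)).ne
    set H₁ := jacobiIterate fl piv H m with hH1
    obtain ⟨J, hJ, hJE⟩ := jacobiRotate_form_error hu hu1 hfl hP hij
    have hherm : (jacobiRotate fl H₁ (piv m).1 (piv m).2).IsHermitian := by
      ext k l
      simpa using jacobiRotate_symm fl (fun k l => symm_apply_of_posDef hP k l) _ _ k l
    obtain ⟨hP', hE'⟩ := eigDesc_relative_perturbation hP hherm J hJ hη0 hη1 fun x =>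
      (hJE x).trans (mul_le_mul_of_nonneg_right (hη m (by omega)) (dotProduct_mulVec_nonneg hP _))
    have hstep : jacobiIterate fl piv H (m + 1) = jacobiRotate fl H₁ (piv m).1 (piv m).2 := rfl
    rw [hstep]
    refine ⟨hP', fun k => ⟨?_, ?_⟩⟩
    · rw [pow_succ']
      have h1 := mul_le_mul_of_nonneg_left (hE k).1 (by linarith : 0 ≤ 1 - η)
      linarith [(hE' k).2]
    · -- `(1 - η) (1 + η) ≤ 1` turns the upper bound into a lower bound for the old eigenvalue
      have h1 := mul_le_mul_of_nonneg_left (hE' k).1 (by linarith : 0 ≤ 1 - η)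
      have h2 : (1 - η) * ((1 + η) * eigDesc H₁ k) ≤ eigDesc H₁ k := by
        nlinarith [eigDesc_pos hP k, mul_nonneg (sq_nonneg η) (eigDesc_pos hP k).le]
      have h3 := mul_le_mul_of_nonneg_left (h1.trans h2)
        (pow_nonneg (by linarith : 0 ≤ 1 - η) m)
      rw [pow_succ, mul_assoc]
      exact h3.trans (hE k).2

/-- Once the stopping criterion holds, the sorted diagonal consists of relatively accurate
eigenvalues. -/
theorem jacobiStop_eig_bounds {n : ℕ} {u tol : ℝ} {fl : ℝ → ℝ} (hu : 0 ≤ u) (hu1 : u ≤ 1 / 10)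
    (hfl : IsRounding u fl) (htol : 0 < tol) {H : Matrix (Fin n) (Fin n) ℝ} (hH : H.PosDef)
    (hcrit : JacobiStop fl tol H) (h1 : 2 * tol * n < 1) (k : Fin n) :
    eigDesc H k ≤ (1 + 2 * tol * n) * H (Tuple.sort (fun i => H i i) k.rev)
        (Tuple.sort (fun i => H i i) k.rev) ∧
      (1 - 2 * tol * n) * H (Tuple.sort (fun i => H i i) k.rev)
        (Tuple.sort (fun i => H i i) k.rev) ≤ eigDesc H k := by
  have hd := diag_pos_of_posDef hH
  set d : Fin n → ℝ := fun i => H i i with hdd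
  have hD : (diagonal d).PosDef := PosDef.diagonal hd
  have hoff : ∀ i j, |(H - diagonal d) i j| ≤ 2 * tol * (√(d i) * √(d j)) := fun i j => by
    rcases eq_or_ne i j with rfl | hij
    · have : (H - diagonal d) i i = 0 := by simp [hdd]
      rw [this, abs_zero]
      positivity
    have h2 : (H - diagonal d) i j = H i j := by simp [hij]
    rw [h2]
    refine (hcrit i j hij).trans ?_
    have hu2 : u < 1 := by linarith
    have h3 : RelClose u 3 (fl (tol * fl √(fl (H i i * H j j)))) (tol * √(H i i * H j j)) := by
      have h4 := ((RelClose.of_rounding hfl hu hu2 (H i i * H j j)).sqrt hu hu2).fl hfl hu hu2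
      exact ((RelClose.refl u tol).mul hu2 h4).fl hfl hu hu2
    have h4 := h3.abs_sub_le hu hu2 (by norm_num; linarith)
    have h5 : 0 ≤ tol * √(H i i * H j j) := by positivity
    rw [abs_of_nonneg h5] at h4
    norm_num at h4
    have h6 := (abs_le.mp h4).2
    have h7 := mul_le_mul_of_nonneg_right (by linarith : 6 * u ≤ 1) h5
    have h8 : √(H i i * H j j) = √(d i) * √(d j) := Real.sqrt_mul (hd i).le _
    rw [← h8]
    linarith
  have hform : ∀ x : Fin n → ℝ, x ⬝ᵥ diagonal d *ᵥ x = ∑ k, d k * x k ^ 2 := fun x => by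
    simp only [dotProduct, mulVec_diagonal]
    exact Finset.sum_congr rfl fun i _ => by ring
  have h2 := (isSortedSpectrum_diagonal d).relative_perturbation
    (isSortedSpectrum_eigDesc hH.isHermitian) hD (LinearEquiv.refl ℝ _) (η := 2 * tol * n)
    (p := 0) (by positivity) h1 one_pos (fun x => by
      rw [LinearEquiv.refl_apply, ← dotProduct_sub, ← sub_mulVec, hform]
      exact abs_form_le_of_abs_apply_le (fun i => (hd i).le) (by positivity) hoff x)
    (fun x => by simp) k
  simpa using h2

/-- The four multiplicative errors (congruence `c`, forming the matrix `b / 2`, rotations `r`,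
stopping criterion `s`) add up to `a + b + c`. -/
theorem abs_sub_div_le_of_factors {l₀ l₁ l₂ l₃ l₄ a b c r s : ℝ} (h₀ : 0 < l₀)
    (h₂ : 0 < l₂) (h₃ : 0 < l₃)
    (ha1 : a < 1) (hb : 0 ≤ b) (hb1 : b < 1) (hc : 0 ≤ c) (hc1 : c < 1)
    (hr : 0 ≤ r) (hra : r ≤ a / 20) (hs : 0 ≤ s) (hsa : s ≤ a / 20)
    (h01 : l₁ ≤ (1 + c) * l₀) (h01' : (1 - c) * l₀ ≤ l₁)
    (h12 : l₂ ≤ (1 + b / 2) * l₁) (h12' : (1 - b / 2) * l₁ ≤ l₂)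
    (h23 : (1 - r) * l₃ ≤ l₂) (h23' : (1 - r) * l₂ ≤ l₃)
    (h34 : (1 - s) * l₄ ≤ l₃) (h34' : l₃ ≤ (1 + s) * l₄) :
    |l₄ - l₀| / l₀ ≤ a + b + c := by
  have ha : 0 ≤ a := by linarith
  have h₄ : 0 < l₄ := by
    by_contra h
    nlinarith
  rw [div_le_iff₀ h₀, abs_le]
  constructor
  · have e1 : (1 - c - b / 2) * l₀ ≤ l₂ := by
      have := mul_le_mul_of_nonneg_left h01' (by linarith : 0 ≤ 1 - b / 2)
      nlinarith [mul_nonneg (mul_nonneg hb hc) h₀.le]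
    have e2 : (1 - a / 20) * l₂ ≤ l₃ := by nlinarith
    have e3 : l₃ ≤ (1 + a / 20) * l₄ := by nlinarith
    have e4 : (1 - a / 20) * l₂ ≤ (1 + a / 20) * l₄ := e2.trans e3
    have e5 : (1 - a) * l₂ ≤ l₄ := by
      nlinarith [mul_nonneg ha h₂.le, mul_nonneg (mul_nonneg ha ha) h₂.le]
    have e6 : (1 - a) * ((1 - c - b / 2) * l₀) ≤ l₄ :=
      (mul_le_mul_of_nonneg_left e1 (by linarith)).trans e5
    nlinarith [mul_nonneg (mul_nonneg ha hb) h₀.le, mul_nonneg (mul_nonneg ha hc) h₀.le,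
      mul_nonneg hb h₀.le]
  · have e1 : l₂ ≤ (1 + c + b) * l₀ := by
      have := mul_le_mul_of_nonneg_left h01 (by linarith : 0 ≤ 1 + b / 2)
      nlinarith [mul_nonneg (mul_nonneg hb (by linarith : 0 ≤ 1 - c)) h₀.le]
    have e2 : (1 - a / 20) * l₄ ≤ l₃ := by nlinarith
    have e3 : (1 - a / 20) * l₃ ≤ l₂ := by nlinarith
    have e4 : (1 - a / 20) * ((1 - a / 20) * l₄) ≤ l₂ :=
      (mul_le_mul_of_nonneg_left e2 (by linarith)).trans e3
    have e5 : l₄ ≤ (1 + a / 3) * l₂ := by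
      have e6 : (1 : ℝ) ≤ (1 + a / 3) * ((1 - a / 20) * (1 - a / 20)) := by
        nlinarith [mul_nonneg ha ha, mul_nonneg (mul_nonneg ha ha) ha]
      have e7 := mul_le_mul_of_nonneg_left e4 (by linarith : 0 ≤ 1 + a / 3)
      have e8 := mul_le_mul_of_nonneg_right e6 h₄.le
      linarith
    have e6 : (1 + a / 3) * l₂ ≤ (1 + a / 3) * ((1 + c + b) * l₀) :=
      mul_le_mul_of_nonneg_left e1 (by linarith)
    nlinarith [mul_nonneg (mul_nonneg ha (by linarith : 0 ≤ 1 - b)) h₀.le,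
      mul_nonneg (mul_nonneg ha (by linarith : 0 ≤ 1 - c)) h₀.le]

/-! ### The run and the total error -/

/-- The rotations of the run: if `a` dominates their accumulated error bound and is less than one,
then the final matrix is positive definite and its eigenvalues are those of the initial matrix up
to the factor `1 - a / 20`. -/
theorem jacobiRun_eig_bounds {n : ℕ} {u a G : ℝ} {S M : ℕ} {fl : ℝ → ℝ} (hu : 0 ≤ u)
    (hfl : IsRounding u fl) {H : Matrix (Fin n) (Fin n) ℝ} (hn : 0 < n) (hH : H.PosDef)
    {piv : ℕ → Fin n × Fin n} (hpiv : ∀ m < M, (piv m).1 < (piv m).2)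
    (hM : M ≤ S * n.choose 2)
    (hG : ∀ m < M, scaledCond2 (jacobiIterate fl piv H m) ≤ G * scaledCond2 H)
    (ha : 400000 * S * |G| * n ^ 2 * u * scaledCond2 H ≤ a) (ha1 : a < 1) :
    (jacobiIterate fl piv H M).PosDef ∧ ∃ r, 0 ≤ r ∧ r ≤ a / 20 ∧ ∀ k,
      (1 - r) * eigDesc H k ≤ eigDesc (jacobiIterate fl piv H M) k ∧
        (1 - r) * eigDesc (jacobiIterate fl piv H M) k ≤ eigDesc H k := by
  have hκ := one_le_scaledCond2 hn hH
  have ha0 : 0 ≤ a := le_trans (by positivity) ha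
  rcases Nat.eq_zero_or_pos M with rfl | hM0
  · exact ⟨hH, 0, le_rfl, by positivity, fun k => by simp [jacobiIterate]⟩
  have hchoose : (n.choose 2 : ℝ) ≤ n ^ 2 := by
    exact_mod_cast (Nat.choose_le_pow n 2)
  have hMn : (M : ℝ) ≤ S * n ^ 2 := by
    have h1 : (M : ℝ) ≤ S * (n.choose 2 : ℝ) := by exact_mod_cast hM
    exact h1.trans (mul_le_mul_of_nonneg_left hchoose (by positivity))
  have hM1 : (1 : ℝ) ≤ M := by exact_mod_cast hM0
  -- the growth hypothesis at `m = 0` forces `1 ≤ G`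
  have hG1 : 1 ≤ |G| := by
    have h1 : scaledCond2 H ≤ G * scaledCond2 H := hG 0 hM0
    have h2 : 1 ≤ G := by nlinarith
    exact h2.trans (le_abs_self G)
  set η := 20000 * u * (|G| * scaledCond2 H) with hη
  have hη0 : 0 ≤ η := by positivity
  have hMη : M * η ≤ a / 20 := by
    calc M * η ≤ (S * n ^ 2) * η := by gcongr
      _ = 400000 * S * |G| * n ^ 2 * u * scaledCond2 H / 20 := by rw [hη]; ring
      _ ≤ a / 20 := by gcongr
  have hηa : η ≤ a / 20 := (le_mul_of_one_le_left hη0 hM1).trans hMη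
  have hGκ : 1 ≤ |G| * scaledCond2 H := one_le_mul_of_one_le_of_one_le hG1 hκ
  have hu1 : u ≤ 1 / 1000 := by
    have h1 : 20000 * u * 1 ≤ η := by rw [hη]; gcongr
    linarith
  obtain ⟨hP, hE⟩ := jacobiIterate_eig_bounds hu hu1 hfl hH hpiv hη0 (by linarith)
    (fun m hm => by
      have h1 : G * scaledCond2 H ≤ |G| * scaledCond2 H :=
        mul_le_mul_of_nonneg_right (le_abs_self G) (by linarith)
      exact mul_le_mul_of_nonneg_left ((hG m hm).trans h1) (by positivity)) M le_rfl
  have hbern : 1 - M * η ≤ (1 - η) ^ M := by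
    have := one_add_mul_le_pow (by linarith : (-2 : ℝ) ≤ -η) M
    rw [← sub_eq_add_neg] at this
    linarith
  refine ⟨hP, M * η, by positivity, hMη, fun k => ⟨?_, ?_⟩⟩
  · exact (mul_le_mul_of_nonneg_right hbern (eigDesc_pos hH k).le).trans (hE k).1
  · exact (mul_le_mul_of_nonneg_right hbern (eigDesc_pos hP k).le).trans (hE k).2

theorem mainTheorem2 (S : ℕ) (τ G : ℝ) :
    ∃ p₂ : Polynomial ℝ, p₂.natDegree ≤ 2 ∧
      ∀ (n : ℕ) (u uh p₁ tol : ℝ) (fl flh : ℝ → ℝ)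
        (A Q Acomp : Matrix (Fin n) (Fin n) ℝ) (piv : ℕ → Fin n × Fin n) (M : ℕ),
        -- the two precisions
        0 < uh → uh < u → n * u < 1 / 2 → u < 0.1 →
        IsRounding u fl → IsRounding uh flh →
        -- the matrix, the preconditioner, and the computed preconditioned matrix
        A.PosDef →
        specNorm (Qᵀ * Q - 1) ≤ p₁ * u → p₁ * u < 1 →
        IsComputedPrecond fl flh A Q Acomp →
        -- the run of the Jacobi algorithm at working precision
        0 < tol → tol ≤ τ * n * u →
        IsJacobiRun fl tol Acomp piv M →
        M ≤ S * n.choose 2 →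
        (∀ m < M, scaledCond2 (jacobiIterate fl piv Acomp m) ≤ G * scaledCond2 Acomp) →
        -- the two assumptions of the theorem
        10 * (n : ℝ) ^ (3 / 2 : ℝ) * u * (1 - p₁ * u)⁻¹ * cond2 A < 1 →
        n * uh / (1 - n * uh) < u →
        -- the three terms of the bound are less than one
        p₂.eval (n : ℝ) * u * scaledCond2 Acomp < 1 →
        (2 * n * u + 8 * n * (n * uh / (1 - n * uh)) * alphaMax A Q) *
          scaledCond2 (Qᵀ * A * Q) < 1 →
        p₁ * u < 1 →
        ∀ k : Fin n,
          |jacobiEig fl Acomp piv M k - eigDesc A k| / eigDesc A k ≤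
            p₂.eval (n : ℝ) * u * scaledCond2 Acomp +
            (2 * n * u + 8 * n * (n * uh / (1 - n * uh)) * alphaMax A Q) *
              scaledCond2 (Qᵀ * A * Q) +
            p₁ * u := by

  -- `400000 = 20 * 20000` and `40 = 20 * 2`: rotations and stopping criterion each use at most one
  -- twentieth of the first term
  refine ⟨Polynomial.C (400000 * S * |G| + 40 * |τ|) * Polynomial.X ^ 2,
    Polynomial.natDegree_C_mul_X_pow_le _ _, ?_⟩
  intro n u uh p₁ tol fl flh A Q Acomp piv M huh huhu hnu hu hfl hflh hA hQ hp hcomp htol htolτ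
    hrun hM hG _ hγ h₁ h₂ _ k
  rw [Polynomial.eval_C_mul, Polynomial.eval_pow, Polynomial.eval_X] at h₁ ⊢
  have hn : 0 < n := k.pos
  have hn1 : (1 : ℝ) ≤ n := by exact_mod_cast hn
  have hu0 : 0 < u := huh.trans huhu
  have hu1 : u ≤ 1 / 10 := by norm_num at hu ⊢; linarith
  have hp0 : 0 ≤ p₁ * u := (norm_nonneg _).trans hQ
  have hnuh : n * uh < 1 / 2 := (mul_le_mul_of_nonneg_left huhu.le (by positivity)).trans_lt hnu
  obtain ⟨hP, hE₁⟩ := eigDesc_congr_bounds hA hQ hp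
  -- forming the preconditioned matrix
  have hentry := hcomp.error_le huh.le (by linarith) (by linarith) hu1 hfl hflh hγ.le hP
  set γ := n * uh / (1 - n * uh) with hγdef
  have hγ0 : 0 ≤ γ := div_nonneg (by positivity) (by linarith)
  have hα0 := alphaMax_nonneg A Q
  set b := (2 * n * u + 8 * n * γ * alphaMax A Q) * scaledCond2 (Qᵀ * A * Q) with hb
  have hκP := one_le_scaledCond2 hn hP
  have hb0 : 0 ≤ b := by positivity
  have hb2 : (u + 4 * γ * alphaMax A Q) * n * scaledCond2 (Qᵀ * A * Q) = b / 2 := by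
    rw [hb]; ring
  have hherm : Acomp.IsHermitian := by
    obtain ⟨Y, Z, -, -, h⟩ := hcomp
    exact h.isHermitian
  obtain ⟨hC, hE₂⟩ := eigDesc_scaled_perturbation hn hP hherm (by positivity)
    (by rw [hb2]; linarith) hentry
  rw [hb2] at hE₂
  -- the rotations
  have hκ := one_le_scaledCond2 hn hC
  set a := (400000 * S * |G| + 40 * |τ|) * (n : ℝ) ^ 2 * u * scaledCond2 Acomp with ha
  have ha' : a = 400000 * S * |G| * n ^ 2 * u * scaledCond2 Acomp +
      40 * |τ| * n ^ 2 * u * scaledCond2 Acomp := by rw [ha]; ring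
  have hτ0 : 0 ≤ 40 * |τ| * n ^ 2 * u * scaledCond2 Acomp := by positivity
  have hG0 : 0 ≤ 400000 * S * |G| * n ^ 2 * u * scaledCond2 Acomp := by positivity
  obtain ⟨hF, r, hr0, hra, hE₃⟩ := jacobiRun_eig_bounds hu0.le hfl hn hC hrun.1 hM hG
    (a := a) (by linarith) h₁
  -- the stopping criterion
  have hs : 2 * tol * n ≤ a / 20 := by
    have h1 : τ * n * u ≤ |τ| * n * u := by gcongr; exact le_abs_self τ
    calc 2 * tol * n ≤ 2 * (|τ| * n * u) * n := by gcongr; exact htolτ.trans h1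
      _ = 2 * |τ| * n ^ 2 * u * 1 := by ring
      _ ≤ 2 * |τ| * n ^ 2 * u * scaledCond2 Acomp := by gcongr
      _ ≤ a / 20 := by linarith
  have hE₄ := jacobiStop_eig_bounds hu0.le hu1 hfl htol hF hrun.2 (by linarith) k
  exact abs_sub_div_le_of_factors (eigDesc_pos hA k) (eigDesc_pos hC k) (eigDesc_pos hF k) h₁
    hb0 h₂ hp0 hp hr0 hra (by positivity) hs (hE₁ k).1 (hE₁ k).2 (hE₂ k).1 (hE₂ k).2 (hE₃ k).2
    (hE₃ k).1 hE₄.2 hE₄.1
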